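/- **Setting.** Let $\mathbb I=[0,1]^2\setminus\{(0,r):r>0\}$ with the lexicographic order (a complete linear order), and write $\hat r=(r,r)$. A continuous ultrametric language $\mathcal L$ is a first-order language with countably many predicate, function and constant symbols, a distinguished binary predicate symbol $d$, and, for every function or predicate symbol $e$, a modulus $\delta_e$ from the positive integers to the positive integers. Formulas are built from atomic formulas and the nullary connectives $\bar r$ ($r\in\mathbb Q\cap[0,1]$) by $\wedge,\to,\forall,\exists$. In a nonempty set $M$ with functions $f^{\mathcal M}:M^n\to M$, constants $c^{\mathcal M}\in M$ and predicates $P^{\mathcal M}:M^n\to\mathbb I$, formulas take values in $\mathbb I$: $\bar r$ has value $\hat r$; $\wedge$ is $\max$; $\varphi\to\psi$ has value $\hat 0$ if $\varphi\ge\psi$ and the value of $\psi$ otherwise; $\forall$ is $\sup$ and $\exists$ is $\inf$ over $M$. A formula is satisfied if its value is $\hat 0$. An (ultrametric) $\mathcal L$-structure $\mathcal M$ is such an interpretation for which, for all $a,b,c\in M$, $d^{\mathcal M}(a,b)=\hat 0\iff a=b$, $d^{\mathcal M}(a,b)=d^{\mathcal M}(b,a)$, $d^{\mathcal M}(a,b)\le\max\{d^{\mathcal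 M}(a,c),d^{\mathcal M}(b,c)\}$, and for all function symbols $f$, predicate symbols $P$, integers $n\ge1$ and tuples $\bar a,\bar b$, with $d(\bar a,\bar b)=\max_i d^{\mathcal M}(a_i,b_i)$: if $d(\bar a,\bar b)<\widehat{\delta_f(n)^{-1}}$ then $d^{\mathcal M}(f^{\mathcal M}(\bar a),f^{\mathcal M}(\bar b))<\widehat{n^{-1}}$; if $d(\bar a,\bar b)<\widehat{\delta_P(n)^{-1}}$ then $d_{\max}(P^{\mathcal M}(\bar a),P^{\mathcal M}(\bar b))<\widehat{n^{-1}}$, where $d_{\max}(x,y)=\hat 0$ if $x=y$ and $\max\{x,y\}$ otherwise. The truth degree of $\varphi(\bar a)$ in $\mathcal M$ is $st_{\mathcal M}(\varphi(\bar a))=\inf\{r\in[0,1]\cap\mathbb Q:\mathcal M\models\bar r\to\varphi(\bar a)\}\in[0,1]$. A weak elementary embedding $j:\mathcal M\to\mathcal N$ is a map $j:M\to N$ commuting with the interpretations of all function and constant symbols and such that $st_{\mathcal M}(\varphi(a_1,\dots,a_n))=st_{\mathcal N}(\varphi(j(a_1),\dots,j(a_n)))$ for every $\mathcal L$-formula $\varphi$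 and all $a_1,\dots,a_n\in M$. **Lemma (Union of chain).** Let $(\mathcal M_i)_{i\in\mathbb N}$ be $\mathcal L$-structures and $f_{i,j}:\mathcal M_i\to\mathcal M_j$ ($i\le j$) weak elementary embeddings with $f_{i,i}=\mathrm{id}$ and $f_{i,j}=f_{k,j}\circ f_{i,k}$ for $i\le k\le j$. Let $\lim M_i$ be the set-theoretic direct limit, i.e. the quotient of the disjoint union $\bigsqcup_i M_i$ by the relation identifying $a\in M_i$ with $b\in M_j$ iff $f_{i,k}(a)=f_{j,k}(b)$ for some $k\ge i,j$. Then there are an $\mathcal L$-structure $\mathcal M_\infty$ with universe $\lim M_i$ and weak elementary embeddings $h_i:\mathcal M_i\to\mathcal M_\infty$ ($i\in\mathbb N$) such that $h_j\circ f_{i,j}=h_i$ for all $i\le j$; moreover $h_i$ is the canonical map $m\mapsto[m]$. -/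

import Mathlib

namespace UML

/-- The set of truth values `[0,1]² \ {(0,r) : r > 0}`, as a subset of the lexicographically
ordered plane. -/
def TruthValue : Type :=
  {p : ℝ ×ₗ ℝ // (ofLex p).1 ∈ Set.Icc (0 : ℝ) 1 ∧ (ofLex p).2 ∈ Set.Icc (0 : ℝ) 1 ∧
    ¬ ((ofLex p).1 = 0 ∧ 0 < (ofLex p).2)}

namespace TruthValue

noncomputable instance : LinearOrder TruthValue :=
  inferInstanceAs (LinearOrder {p : ℝ ×ₗ ℝ // (ofLex p).1 ∈ Set.Icc (0 : ℝ) 1 ∧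
    (ofLex p).2 ∈ Set.Icc (0 : ℝ) 1 ∧ ¬ ((ofLex p).1 = 0 ∧ 0 < (ofLex p).2)})

/-- First coordinate of a truth value. -/
def fst (x : TruthValue) : ℝ := (ofLex x.1).1

/-- Second coordinate of a truth value. -/
def snd (x : TruthValue) : ℝ := (ofLex x.1).2

theorem le_iff {x y : TruthValue} :
    x ≤ y ↔ x.fst < y.fst ∨ (x.fst = y.fst ∧ x.snd ≤ y.snd) :=
  Prod.Lex.le_iff (x := x.1) (y := y.1)

theorem fst_mem (x : TruthValue) : x.fst ∈ Set.Icc (0 : ℝ) 1 := x.2.1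

theorem snd_mem (x : TruthValue) : x.snd ∈ Set.Icc (0 : ℝ) 1 := x.2.2.1

theorem snd_eq_zero {x : TruthValue} (h : x.fst = 0) : x.snd = 0 := by
  have h1 := x.snd_mem.1
  by_contra h2
  exact x.2.2.2 ⟨h, lt_of_le_of_ne h1 (Ne.symm h2)⟩

/-- Every set of truth values has a least upper bound. -/
theorem exists_isLUB (s : Set TruthValue) : ∃ x, IsLUB s x := by
  have bdd1 : BddAbove (fst '' s) := ⟨1, by rintro _ ⟨x, -, rfl⟩; exact x.fst_mem.2⟩
  set a : ℝ := sSup (fst '' s) with ha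
  set t : Set ℝ := {r | ∃ x ∈ s, x.fst = a ∧ x.snd = r} with ht
  have bdd2 : BddAbove t := ⟨1, by rintro _ ⟨x, -, -, rfl⟩; exact x.snd_mem.2⟩
  have ha0 : 0 ≤ a := Real.sSup_nonneg (by rintro _ ⟨x, -, rfl⟩; exact x.fst_mem.1)
  have ha1 : a ≤ 1 := Real.sSup_le (by rintro _ ⟨x, -, rfl⟩; exact x.fst_mem.2) zero_le_one
  have hb0 : 0 ≤ sSup t := Real.sSup_nonneg (by rintro _ ⟨x, -, -, rfl⟩; exact x.snd_mem.1)
  have hb1 : sSup t ≤ 1 :=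
    Real.sSup_le (by rintro _ ⟨x, -, -, rfl⟩; exact x.snd_mem.2) zero_le_one
  have hne : ¬ (a = 0 ∧ 0 < sSup t) := by
    rintro ⟨h0, h1⟩
    refine absurd (Real.sSup_le (s := t) ?_ le_rfl) (not_le.2 h1)
    rintro _ ⟨x, -, hx, rfl⟩
    exact (snd_eq_zero (hx.trans h0)).le
  refine ⟨⟨toLex (a, sSup t), ⟨ha0, ha1⟩, ⟨hb0, hb1⟩, hne⟩, ?_, ?_⟩
  · intro x hx
    have h1 : x.fst ≤ a := le_csSup bdd1 ⟨x, hx, rfl⟩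
    rcases h1.lt_or_eq with h | h
    · exact le_iff.2 (Or.inl h)
    · exact le_iff.2 (Or.inr ⟨h, le_csSup bdd2 ⟨x, hx, h, rfl⟩⟩)
  · intro y hy
    have h1 : a ≤ y.fst := by
      refine Real.sSup_le ?_ y.fst_mem.1
      rintro _ ⟨x, hx, rfl⟩
      rcases le_iff.1 (hy hx) with h | h
      · exact h.le
      · exact h.1.le
    rcases h1.lt_or_eq with h | h
    · exact le_iff.2 (Or.inl h)
    · refine le_iff.2 (Or.inr ⟨h, Real.sSup_le ?_ y.snd_mem.1⟩)
      rintro _ ⟨x, hx, hxa, rfl⟩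
      rcases le_iff.1 (hy hx) with h' | h'
      · exact absurd h' (by rw [hxa, h]; exact lt_irrefl _)
      · exact h'.2

theorem exists_isGLB (s : Set TruthValue) : ∃ x, IsGLB s x := by
  obtain ⟨x, hx⟩ := exists_isLUB (lowerBounds s)
  exact ⟨x, isLUB_lowerBounds.1 hx⟩

/-- The element `r̂ = (r, r)`, for `r` a rational number in `[0,1]`. -/
noncomputable def hat (r : Set.Icc (0 : ℚ) 1) : TruthValue :=
  have h0 : (0 : ℝ) ≤ ((r : ℚ) : ℝ) := by exact_mod_cast r.2.1
  have h1 : ((r : ℚ) : ℝ) ≤ 1 := by exact_mod_cast r.2.2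
  ⟨toLex (((r : ℚ) : ℝ), ((r : ℚ) : ℝ)), ⟨h0, h1⟩, ⟨h0, h1⟩, fun h => h.2.ne' h.1⟩

theorem hat_zero_le (x : TruthValue) : hat 0 ≤ x := by
  have h0 : (hat 0).fst = 0 := by simp [hat, fst]
  have h1 : (hat 0).snd = 0 := by simp [hat, snd]
  rcases x.fst_mem.1.lt_or_eq with h | h
  · exact le_iff.2 (Or.inl (by rw [h0]; exact h))
  · exact le_iff.2 (Or.inr ⟨by rw [h0]; exact h, by rw [h1]; exact x.snd_mem.1⟩)

theorem le_hat_one (x : TruthValue) : x ≤ hat 1 := by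
  have h0 : (hat 1).fst = 1 := by simp [hat, fst]
  have h1 : (hat 1).snd = 1 := by simp [hat, snd]
  rcases x.fst_mem.2.lt_or_eq with h | h
  · exact le_iff.2 (Or.inl (by rw [h0]; exact h))
  · exact le_iff.2 (Or.inr ⟨by rw [h0]; exact h, by rw [h1]; exact x.snd_mem.2⟩)

/-- The truth values form a complete lattice (for the lexicographic order). -/
noncomputable instance : CompleteLattice TruthValue where
  __ := (inferInstance : Lattice TruthValue)
  sSup s := (exists_isLUB s).choose
  sInf s := (exists_isGLB s).choose
  isLUB_sSup s := (exists_isLUB s).choose_spec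
  isGLB_sInf s := (exists_isGLB s).choose_spec
  top := hat 1
  le_top := le_hat_one
  bot := hat 0
  bot_le := hat_zero_le

/-- The truth value `(1/n, 1/n)`, for a positive integer `n`. -/
noncomputable def invNat (n : ℕ+) : TruthValue :=
  hat ⟨((n : ℕ) : ℚ)⁻¹, by positivity, inv_le_one_of_one_le₀ (by exact_mod_cast n.one_le)⟩

open Classical in
/-- `d_max(x, y)` is `0̂` if `x = y`, and `max x y` otherwise. -/
noncomputable def dmax (x y : TruthValue) : TruthValue := if x = y then hat 0 else max x y

open Classical in
/-- Truth value of an implication (recall that `0̂` is absolute truth). -/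
noncomputable def imp (x y : TruthValue) : TruthValue := if y ≤ x then hat 0 else y

end TruthValue

open TruthValue

universe u v w w'

/-- A continuous ultrametric language: a first-order language (constant symbols are the function
symbols of arity `0`) with a distinguished binary predicate symbol and a modulus of uniform
continuity for each function and predicate symbol. For symbols of arity `0` the modulus puts no
condition on structures. -/
structure UltrametricLanguage where
  /-- The underlying first-order language. -/
  lang : FirstOrder.Language.{u, v}
  /-- The distinguished binary predicate symbol `d`. -/
  d : lang.Relations 2
  /-- The moduli `δ_f`. -/
  funModulus : ∀ {n : ℕ}, lang.Functions n → ℕ+ → ℕ+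
  /-- The moduli `δ_P`. -/
  relModulus : ∀ {n : ℕ}, lang.Relations n → ℕ+ → ℕ+

/-- Formulas of rational Gödel logic, with variables `x₀, x₁, …`. The other connectives
(`¬`, `∨`, `↔`, `⇒`) are abbreviations in terms of these. -/
inductive Formula (L : FirstOrder.Language.{u, v}) : Type (max u v)
  | const (r : Set.Icc (0 : ℚ) 1) : Formula L
  | pred {n : ℕ} (P : L.Relations n) (t : Fin n → L.Term ℕ) : Formula L
  | and (φ ψ : Formula L) : Formula L
  | imp (φ ψ : Formula L) : Formula L
  | all (x : ℕ) (φ : Formula L) : Formula L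
  | ex (x : ℕ) (φ : Formula L) : Formula L

/-- Structures of rational Gödel logic with universe `M`. -/
structure GodelStructure (L : FirstOrder.Language.{u, v}) (M : Type w) where
  nonempty : Nonempty M
  /-- Interpretation of function (and constant) symbols. -/
  funMap : ∀ {n : ℕ}, L.Functions n → (Fin n → M) → M
  /-- Interpretation of predicate symbols. -/
  relMap : ∀ {n : ℕ}, L.Relations n → (Fin n → M) → TruthValue

namespace GodelStructure

variable {L : FirstOrder.Language.{u, v}} {M : Type w}

/-- Value of a term under an assignment of the variables. -/
def termVal (S : GodelStructure L M) (σ : ℕ → M) : L.Term ℕ → M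
  | .var x => σ x
  | .func f t => S.funMap f fun i => S.termVal σ (t i)

/-- Truth value of a formula under an assignment of the variables. -/
noncomputable def val (S : GodelStructure L M) : Formula L → (ℕ → M) → TruthValue
  | .const r, _ => hat r
  | .pred P t, σ => S.relMap P fun i => S.termVal σ (t i)
  | .and φ ψ, σ => max (S.val φ σ) (S.val ψ σ)
  | .imp φ ψ, σ => TruthValue.imp (S.val φ σ) (S.val ψ σ)
  | .all x φ, σ => ⨆ a : M, S.val φ (Function.update σ x a)
  | .ex x φ, σ => ⨅ a : M, S.val φ (Function.update σ x a)

/-- A formula is satisfied if its truth value is `0̂`. -/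
def Satisfies (S : GodelStructure L M) (φ : Formula L) (σ : ℕ → M) : Prop :=
  S.val φ σ = hat 0

/-- The truth degree `inf {r ∈ [0,1] ∩ ℚ : S ⊨ r → φ}`, a real number in `[0,1]`
(the set always contains `1`). -/
noncomputable def truthDegree (S : GodelStructure L M) (φ : Formula L) (σ : ℕ → M) : ℝ :=
  sInf {x : ℝ | ∃ r : Set.Icc (0 : ℚ) 1,
    x = ((r : ℚ) : ℝ) ∧ S.Satisfies (.imp (.const r) φ) σ}

end GodelStructure

/-- Ultrametric structures with universe `M`. -/
structure UltrametricStructure (L : UltrametricLanguage.{u, v}) (M : Type w) extends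
    GodelStructure L.lang M where
  d_self : ∀ a : M, relMap L.d ![a, a] = hat 0
  d_comm : ∀ a b : M, relMap L.d ![a, b] = relMap L.d ![b, a]
  d_triangle : ∀ a b c : M,
    relMap L.d ![a, b] ≤ max (relMap L.d ![a, c]) (relMap L.d ![b, c])
  eq_of_d_eq : ∀ a b : M, relMap L.d ![a, b] = hat 0 → a = b
  /-- Uniform continuity of functions; the distance of two tuples is the maximum (`0̂` for empty
  tuples) of the distances of their entries. -/
  fun_unifCont : ∀ {k : ℕ} (f : L.lang.Functions k) (n : ℕ+) (a b : Fin k → M),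
    (⨆ i, relMap L.d ![a i, b i]) < invNat (L.funModulus f n) →
      relMap L.d ![funMap f a, funMap f b] < invNat n
  /-- Uniform continuity of predicates. -/
  rel_unifCont : ∀ {k : ℕ} (P : L.lang.Relations k) (n : ℕ+) (a b : Fin k → M),
    (⨆ i, relMap L.d ![a i, b i]) < invNat (L.relModulus P n) →
      dmax (relMap P a) (relMap P b) < invNat n

/-- Weak elementary embeddings: maps that commute with the interpretations of the function symbols
and preserve the truth degrees of all formulas with parameters. -/
structure WeakElementaryEmbedding {L : UltrametricLanguage.{u, v}} {M : Type w} {N : Type w'}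
    (S : UltrametricStructure L M) (T : UltrametricStructure L N) where
  /-- The underlying map of universes. -/
  toFun : M → N
  map_fun : ∀ {k : ℕ} (f : L.lang.Functions k) (a : Fin k → M),
    toFun (S.funMap f a) = T.funMap f (toFun ∘ a)
  truthDegree_eq : ∀ (φ : Formula L.lang) (σ : ℕ → M),
    S.truthDegree φ σ = T.truthDegree φ (toFun ∘ σ)

instance {L : UltrametricLanguage.{u, v}} {M : Type w} {N : Type w'}
    (S : UltrametricStructure L M) (T : UltrametricStructure L N) :
    FunLike (WeakElementaryEmbedding S T) M N where
  coe := WeakElementaryEmbedding.toFun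
  coe_injective := by
    rintro ⟨f, _, _⟩ ⟨g, _, _⟩ h
    congr

end UML

/-! The truth degree of a formula is the first coordinate of its value, so weak elementary
embeddings preserve first coordinates. Applied to implications, which take the value `0̂` exactly
when an inequality holds, they also preserve the order between values (`val_le_val_iff`). Only
second coordinates may move along the chain, so the limit has to invent them.

Take the germ, along a nonprincipal ultrafilter, of the values of a formula at the successive
stages: a nonstandard truth value with standard first coordinate. The germs of all formulas form a
linear order `D`, to be embedded into the truth values by a map `G` that keeps first coordinates and
every `r̂`. In the fibre over `r`, germs coming from one stage are ordered by their real second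
coordinates there. Hence countably many upper sets separate the fibre, and Debreu's theorem embeds
it into `[0,1]` continuously, preserving existing suprema and infima (`exists_fiber_embedding`).

In the limit structure every formula has value `G` of its germ (`val_limGodel`). Connectives depend
only on the order and `0̂`; a quantified formula is the least upper or greatest lower bound in `D`
of its instances. The delicate case is a bound whose first coordinate `r` no instance attains: it is
then `(r, 0)` for a supremum and, when `r > 0`, `(r, 1)` for an infimum at every late stage, and `G`
fixes these points (`real_hyperVal_all`, `real_hyperVal_ex`). -/

section MonotoneEmbedding

open Set Topology

/-! ### Debreu's theorem: continuous order embeddings into the reals. -/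

section OrderTopology

variable {X : Type*} [LinearOrder X] [TopologicalSpace X]

/-- A linear order whose points are separated by countably many monotone continuous functions into
`[0,1]` has a strictly monotone continuous function. -/
theorem exists_strictMono_continuous_of_countable (H : Set (X → ℝ)) (hc : H.Countable)
    (hH : ∀ h ∈ H, Monotone h ∧ Continuous h ∧ ∀ x, h x ∈ Icc (0 : ℝ) 1)
    (hsep : ∀ x y : X, x < y → ∃ h ∈ H, h x < h y) :
    ∃ g : X → ℝ, StrictMono g ∧ Continuous g := by
  rcases H.eq_empty_or_nonempty with rfl | hne
  · exact ⟨fun _ => 0, fun x y hxy => by simpa using hsep x y hxy, continuous_const⟩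
  obtain ⟨h, rfl⟩ := hc.exists_eq_range hne
  have hh := fun n => hH (h n) ⟨n, rfl⟩
  have hle : ∀ n x, (1 / 2 : ℝ) ^ n * h n x ≤ (1 / 2 : ℝ) ^ n := fun n x =>
    mul_le_of_le_one_right (by positivity) ((hh n).2.2 x).2
  have h0 : ∀ n x, 0 ≤ (1 / 2 : ℝ) ^ n * h n x := fun n x =>
    mul_nonneg (by positivity) ((hh n).2.2 x).1
  have hs : ∀ x, Summable fun n => (1 / 2 : ℝ) ^ n * h n x := fun x =>
    summable_geometric_two.of_nonneg_of_le (fun n => h0 n x) fun n => hle n x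
  refine ⟨fun x => ∑' n, (1 / 2 : ℝ) ^ n * h n x, fun x y hxy => ?_,
    continuous_tsum (fun n => continuous_const.mul (hh n).2.1) summable_geometric_two
      fun n x => ?_⟩
  · obtain ⟨_, ⟨n, rfl⟩, hn⟩ := hsep x y hxy
    refine Summable.tsum_lt_tsum (i := n) (fun m => ?_) ?_ (hs x) (hs y)
    · exact mul_le_mul_of_nonneg_left ((hh m).1 hxy.le) (by positivity)
    · exact mul_lt_mul_of_pos_left hn (by positivity)
  · rw [Real.norm_of_nonneg (h0 n x)]
    exact hle n x

namespace Urysohns.CU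

/-- The initial approximant is the indicator of an upper set, and the later ones are midpoints of
monotone functions. -/
theorem monotone_approx {P : Set X → Set X → Prop} (hP : ∀ c u, P c u → IsLowerSet u)
    (n : ℕ) (c : CU P) : Monotone (c.approx n) := by
  induction n generalizing c with
  | zero =>
    intro x y hxy
    simp only [approx]
    by_cases hx : x ∈ c.Uᶜ
    · have hy : y ∈ c.Uᶜ := fun hy => hx (hP _ _ c.P_C_U hxy hy)
      rw [indicator_of_mem hx, indicator_of_mem hy, Pi.one_apply, Pi.one_apply]
    · rw [indicator_of_notMem hx]
      exact indicator_nonneg (fun _ _ => zero_le_one) _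
  | succ n ih =>
    intro x y hxy
    simp only [approx]
    exact midpoint_le_midpoint (ih _ hxy) (ih _ hxy)

theorem monotone_lim {P : Set X → Set X → Prop} (hP : ∀ c u, P c u → IsLowerSet u)
    (c : CU P) : Monotone c.lim := fun x y hxy =>
  le_of_tendsto_of_tendsto' (c.tendsto_approx_atTop x) (c.tendsto_approx_atTop y)
    fun n => monotone_approx hP n c hxy

end Urysohns.CU

variable [OrderTopology X]

/-- Taking the closure adds at most the point `z` to the ray. -/
theorem isLowerSet_closure_Iio (z : X) : IsLowerSet (closure (Iio z)) := by
  intro x y hyx hx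
  rcases lt_or_ge y z with h | h
  · exact subset_closure h
  · have hxz : x ≤ z := closure_minimal Iio_subset_Iic_self isClosed_Iic hx
    exact le_antisymm hyx (hxz.trans h) ▸ hx

/-- Urysohn's lemma for linear orders: two points are separated by a monotone continuous
function. -/
theorem exists_monotone_continuous_separating {a b : X} (hab : a < b) :
    ∃ h : X → ℝ, Monotone h ∧ Continuous h ∧ (∀ x, h x ∈ Icc (0 : ℝ) 1) ∧ h a = 0 ∧ h b = 1 := by
  -- Running Urysohn's construction through lower sets only makes the resulting function monotone.
  let P : Set X → Set X → Prop := fun c u => IsLowerSet c ∧ IsLowerSet u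
  let c : Urysohns.CU P :=
    { C := Iic a
      U := Iio b
      P_C_U := ⟨isLowerSet_Iic a, isLowerSet_Iio b⟩
      closed_C := isClosed_Iic
      open_U := isOpen_Iio
      subset := Iic_subset_Iio.2 hab
      hP := by
        rintro c u hc ⟨hlc, hlu⟩ hu hcu
        -- If `c = u`, this set is clopen and interpolates itself; otherwise the ray below a point
        -- of `u \ c` does.
        rcases hcu.eq_or_ssubset with rfl | hss
        · exact ⟨c, hu, subset_rfl, hc.closure_eq.subset, ⟨hlc, hlc⟩, by
            rw [hc.closure_eq]; exact ⟨hlc, hlc⟩⟩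
        · obtain ⟨z, hzu, hzc⟩ := exists_of_ssubset hss
          refine ⟨Iio z, isOpen_Iio, fun y hy => ?_, ?_, ⟨hlc, isLowerSet_Iio z⟩,
            isLowerSet_closure_Iio z, hlu⟩
          · exact lt_of_not_ge fun h => hzc (hlc h hy)
          · exact (closure_minimal Iio_subset_Iic_self isClosed_Iic).trans
              fun y hy => hlu hy hzu }
  exact ⟨c.lim, c.monotone_lim fun _ _ h => h.2, c.continuous_lim, c.lim_mem_Icc,
    c.lim_of_mem_C a (mem_Iic.2 le_rfl), c.lim_of_notMem_U b (lt_irrefl b)⟩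

/-- Debreu's theorem: a linear order whose points are separated by countably many upper sets has a
strictly monotone continuous real function. -/
theorem exists_strictMono_continuous_of_upperSets {ι : Type*} [Countable ι] (U : ι → Set X)
    (hU : ∀ i, IsUpperSet (U i)) (hsep : ∀ x y : X, x < y → ∃ i, x ∉ U i ∧ y ∈ U i) :
    ∃ g : X → ℝ, StrictMono g ∧ Continuous g := by
  classical
  let h : ∀ p : {p : X × X // p.1 < p.2}, X → ℝ := fun p =>
    (exists_monotone_continuous_separating p.2).choose
  have hh : ∀ p, Monotone (h p) ∧ Continuous (h p) ∧ (∀ x, h p x ∈ Icc (0 : ℝ) 1) ∧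
      h p p.1.1 = 0 ∧ h p p.1.2 = 1 := fun p =>
    (exists_monotone_continuous_separating p.2).choose_spec
  -- Countably many pairs will suffice: one representative of each nonempty `A q`, and the jumps, of
  -- which each `U i` separates at most one.
  let A : ι × ι → Set {p : X × X // p.1 < p.2} := fun q => {p | p.1.1 ∈ U q.1 ∧ p.1.2 ∉ U q.2}
  let J : ι → Set {p : X × X // p.1 < p.2} := fun i => {p | p.1.1 ∉ U i ∧ p.1.2 ∈ U i ∧
    p.1.1 ⋖ p.1.2}
  let A' : ι × ι → Set {p : X × X // p.1 < p.2} := fun q =>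
    if hq : (A q).Nonempty then {hq.choose} else ∅
  have hA' : ∀ q, (A' q).Countable := fun q => by
    by_cases hq : (A q).Nonempty <;> simp [A', hq]
  have hJ : ∀ i, (J i).Countable := fun i => by
    refine Set.Subsingleton.countable ?_
    rintro ⟨⟨u, v⟩, huv⟩ ⟨hu, hv, hc⟩ ⟨⟨u', v'⟩, huv'⟩ ⟨hu', hv', hc'⟩
    dsimp only at *
    have h1 : ∀ {s t}, s ∉ U i → t ∈ U i → s < t := fun hs ht =>
      lt_of_not_ge fun hle => hs (hU i hle ht)
    have e1 : u = u' := le_antisymm (hc'.le_of_lt (h1 hu hv')) (hc.le_of_lt (h1 hu' hv))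
    have e2 : v = v' := le_antisymm (hc.ge_of_gt (h1 hu hv')) (hc'.ge_of_gt (h1 hu' hv))
    subst e1 e2
    rfl
  refine exists_strictMono_continuous_of_countable (h '' ((⋃ q, A' q) ∪ ⋃ i, J i))
    (((countable_iUnion hA').union (countable_iUnion hJ)).image _) ?_ ?_
  · rintro _ ⟨p, -, rfl⟩
    exact ⟨(hh p).1, (hh p).2.1, (hh p).2.2.1⟩
  · intro x y hxy
    suffices ∃ p ∈ (⋃ q, A' q) ∪ ⋃ i, J i, x ≤ p.1.1 ∧ p.1.2 ≤ y by
      obtain ⟨p, hp, hx, hy⟩ := this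
      refine ⟨_, ⟨p, hp, rfl⟩, ((hh p).1 hx).trans_lt (lt_of_lt_of_le ?_ ((hh p).1 hy))⟩
      rw [(hh p).2.2.2.1, (hh p).2.2.2.2]
      exact zero_lt_one
    by_cases hj : ∃ u v, x ≤ u ∧ v ≤ y ∧ u ⋖ v
    · obtain ⟨u, v, hu, hv, huv⟩ := hj
      obtain ⟨i, hi⟩ := hsep u v huv.lt
      exact ⟨⟨(u, v), huv.lt⟩, Or.inr (mem_iUnion.2 ⟨i, hi.1, hi.2, huv⟩), hu, hv⟩
    -- Without jumps, two more points `z < w` fit between `x` and `y`. The representative of `A (i,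
    -- k)` stays between `x` and `y`: its left end lies in `U i`, which omits `x`, and its right end
    -- is outside `U k`, which contains `y`.
    · push Not at hj
      obtain ⟨z, hxz, hzy⟩ := (not_covBy_iff hxy).1 (hj x y le_rfl le_rfl)
      obtain ⟨w, hzw, hwy⟩ := (not_covBy_iff hzy).1 (hj z y hxz.le le_rfl)
      obtain ⟨i, hi⟩ := hsep x z hxz
      obtain ⟨k, hk⟩ := hsep w y hwy
      have hne : (A (i, k)).Nonempty := ⟨⟨(z, w), hzw⟩, hi.2, hk.1⟩
      refine ⟨hne.choose, Or.inl (mem_iUnion.2 ⟨(i, k), ?_⟩), ?_, ?_⟩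
      · simp only [A', dif_pos hne, mem_singleton_iff]
      · exact le_of_not_ge fun hle => hi.1 (hU i hle hne.choose_spec.1)
      · exact le_of_not_ge fun hle => hne.choose_spec.2 (hU k hle hk.2)

end OrderTopology

/-- In a linear order with end points `a`, `b` whose points are separated by countably many upper
sets, one can find a strictly monotone function into `[0,1]` that preserves suprema and infima, maps
`a` to `0` and `b` to `1`, and has a prescribed value at a given point. -/
theorem exists_strictMono_unitInterval {X : Type*} [LinearOrder X] {ι : Type*} [Countable ι]
    (U : ι → Set X) (hU : ∀ i, IsUpperSet (U i))
    (hsep : ∀ x y : X, x < y → ∃ i, x ∉ U i ∧ y ∈ U i)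
    {a b c : X} (ha : ∀ x, a ≤ x) (hac : a < c)
    {r : ℝ} (hr0 : 0 < r) (hr : c < b ∧ r < 1 ∨ c = b ∧ r = 1) :
    ∃ g : X → ℝ, StrictMono g ∧ g a = 0 ∧ g b = 1 ∧ g c = r ∧
      (∀ B x, B.Nonempty → IsLUB B x → IsLUB (g '' B) (g x)) ∧
      (∀ B x, B.Nonempty → IsGLB B x → IsGLB (g '' B) (g x)) := by
  let _ : TopologicalSpace X := Preorder.topology X
  have _ : OrderTopology X := ⟨rfl⟩
  obtain ⟨g, hg, hgc⟩ := exists_strictMono_continuous_of_upperSets U hU hsep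
  have hab : 0 < g b - g a := sub_pos.2 (hg (hac.trans_le (hr.elim (·.1.le) (·.1.le))))
  let k : X → ℝ := fun x => (g x - g a) / (g b - g a)
  have hk : StrictMono k := fun x y hxy =>
    div_lt_div_of_pos_right (sub_lt_sub_right (hg hxy) _) hab
  have hkc : Continuous k := (hgc.sub continuous_const).div_const _
  have hka : k a = 0 := by simp [k]
  have hkb : k b = 1 := div_self hab.ne'
  have h0 : ∀ x, 0 ≤ k x := fun x => hka ▸ hk.monotone (ha x)
  have hc0 : 0 < k c := hka ▸ hk hac
  -- A power map keeps `0` and `1` fixed and can move `k c` to the prescribed value.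
  obtain ⟨p, hp, hpr⟩ : ∃ p : ℝ, 0 < p ∧ k c ^ p = r := by
    rcases hr with ⟨hcb, hr1⟩ | ⟨rfl, rfl⟩
    · have hc1 : k c < 1 := hkb ▸ hk hcb
      refine ⟨Real.log r / Real.log (k c),
        div_pos_of_neg_of_neg (Real.log_neg hr0 hr1) (Real.log_neg hc0 hc1), ?_⟩
      rw [Real.rpow_def_of_pos hc0, mul_div_cancel₀ _ (Real.log_neg hc0 hc1).ne,
        Real.exp_log hr0]
    · exact ⟨1, one_pos, by rw [hkb, Real.one_rpow]⟩
  have hm : StrictMono fun x => k x ^ p := fun x y hxy =>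
    Real.rpow_lt_rpow (h0 x) (hk hxy) hp
  have hcont : Continuous fun x => k x ^ p :=
    hkc.rpow_const fun _ => Or.inr hp.le
  refine ⟨_, hm, ?_, ?_, hpr, fun B x hB hx => ?_, fun B x hB hx => ?_⟩
  · simp only [hka, Real.zero_rpow hp.ne']
  · simp only [hkb, Real.one_rpow]
  · exact hx.isLUB_of_tendsto (hm.monotone.monotoneOn _) hB hcont.continuousWithinAt
  · exact hx.isGLB_of_tendsto (hm.monotone.monotoneOn _) hB hcont.continuousWithinAt

end MonotoneEmbedding

/-! ### Coordinates of truth values. -/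

namespace UML

open Filter Set TruthValue

namespace TruthValue

@[simp] theorem fst_hat (r : Icc (0 : ℚ) 1) : (hat r).fst = ((r : ℚ) : ℝ) := rfl

theorem ext {x y : TruthValue} (h1 : x.fst = y.fst) (h2 : x.snd = y.snd) : x = y :=
  le_antisymm (le_iff.2 (Or.inr ⟨h1, h2.le⟩)) (le_iff.2 (Or.inr ⟨h1.symm, h2.ge⟩))

theorem lt_iff {x y : TruthValue} :
    x < y ↔ x.fst < y.fst ∨ (x.fst = y.fst ∧ x.snd < y.snd) :=
  Prod.Lex.lt_iff (x := x.1) (y := y.1)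

theorem fst_mono {x y : TruthValue} (h : x ≤ y) : x.fst ≤ y.fst :=
  (le_iff.1 h).elim (·.le) (·.1.le)

theorem lt_of_fst_lt {x y : TruthValue} (h : x.fst < y.fst) : x < y := lt_iff.2 (Or.inl h)

theorem hat_zero : hat 0 = ⊥ := rfl

theorem fst_bot : (⊥ : TruthValue).fst = 0 := by rw [← hat_zero]; simp

/-- The points `(0, s)` with `s > 0` are excluded, so first coordinate `0` determines the value. -/
theorem eq_bot_of_fst {x : TruthValue} (h : x.fst = 0) : x = ⊥ :=
  ext (h.trans fst_bot.symm) ((snd_eq_zero h).trans (snd_eq_zero fst_bot).symm)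

theorem fst_eq_zero_iff {x : TruthValue} : x.fst = 0 ↔ x = ⊥ :=
  ⟨eq_bot_of_fst, fun h => h ▸ fst_bot⟩

theorem imp_of_le {x y : TruthValue} (h : y ≤ x) : imp x y = hat 0 := if_pos h

theorem imp_of_lt {x y : TruthValue} (h : x < y) : imp x y = y := if_neg h.not_ge

theorem imp_eq_bot_iff {x y : TruthValue} : imp x y = ⊥ ↔ y ≤ x := by
  rcases le_or_gt y x with h | h
  · simp [imp_of_le h, h, hat_zero]
  · rw [imp_of_lt h]
    exact ⟨fun h0 => h0 ▸ bot_le, fun h' => absurd h' h.not_ge⟩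

theorem bot_lt_invNat (n : ℕ+) : ⊥ < invNat n := by
  refine lt_of_fst_lt ?_
  rw [fst_bot, invNat, fst_hat]
  have : (0 : ℚ) < ((n : ℕ) : ℚ)⁻¹ := inv_pos.2 (by exact_mod_cast n.pos)
  exact_mod_cast this

theorem exists_hat_between {a b : ℝ} (ha : 0 ≤ a) (hb : b ≤ 1) (hab : a < b) :
    ∃ q : Icc (0 : ℚ) 1, a < ((q : ℚ) : ℝ) ∧ ((q : ℚ) : ℝ) < b := by
  obtain ⟨q, h1, h2⟩ := exists_rat_btwn hab
  exact ⟨⟨q, by exact_mod_cast ha.trans h1.le, by exact_mod_cast h2.le.trans hb⟩, h1, h2⟩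

/-- The truth value `(r, s)` for `r ∈ (0,1]` and `s ∈ [0,1]`. -/
def ofMem (r s : ℝ) (h : r ∈ Ioc (0 : ℝ) 1 ∧ s ∈ Icc (0 : ℝ) 1) : TruthValue :=
  ⟨toLex (r, s), ⟨h.1.1.le, h.1.2⟩, h.2, fun h' => h.1.1.ne' h'.1⟩

open Classical in
/-- The truth value `(r, s)` for `r ∈ (0,1]` and `s ∈ [0,1]`, and `0̂` for other `r` or `s`. -/
noncomputable def pair (r s : ℝ) : TruthValue :=
  if h : r ∈ Ioc (0 : ℝ) 1 ∧ s ∈ Icc (0 : ℝ) 1 then ofMem r s h else ⊥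

theorem fst_pair {r s : ℝ} (hr : r ∈ Ioc (0 : ℝ) 1) (hs : s ∈ Icc (0 : ℝ) 1) :
    (pair r s).fst = r := by
  rw [pair, dif_pos ⟨hr, hs⟩]; rfl

theorem snd_pair {r s : ℝ} (hr : r ∈ Ioc (0 : ℝ) 1) (hs : s ∈ Icc (0 : ℝ) 1) :
    (pair r s).snd = s := by
  rw [pair, dif_pos ⟨hr, hs⟩]; rfl

theorem pair_fst_snd {x : TruthValue} (h : 0 < x.fst) : pair x.fst x.snd = x :=
  ext (fst_pair ⟨h, x.fst_mem.2⟩ x.snd_mem) (snd_pair ⟨h, x.fst_mem.2⟩ x.snd_mem)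

theorem pair_zero_le {x : TruthValue} {r : ℝ} (h : x.fst = r) : pair r 0 ≤ x := by
  rcases x.fst_mem.1.eq_or_lt with h0 | h0
  · have : ¬ r ∈ Ioc (0 : ℝ) 1 := fun hr => hr.1.ne (h0.trans h)
    rw [pair, dif_neg fun h => this h.1]
    exact bot_le
  · subst h
    have hr : x.fst ∈ Ioc (0 : ℝ) 1 := ⟨h0, x.fst_mem.2⟩
    refine le_iff.2 (Or.inr ⟨fst_pair hr (left_mem_Icc.2 zero_le_one), ?_⟩)
    rw [snd_pair hr (left_mem_Icc.2 zero_le_one)]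
    exact x.snd_mem.1

theorem le_pair_one {x : TruthValue} {r : ℝ} (h : x.fst = r) : x ≤ pair r 1 := by
  rcases x.fst_mem.1.eq_or_lt with h0 | h0
  · rw [eq_bot_of_fst h0.symm]
    exact bot_le
  · subst h
    have hr : x.fst ∈ Ioc (0 : ℝ) 1 := ⟨h0, x.fst_mem.2⟩
    refine le_iff.2 (Or.inr ⟨(fst_pair hr (right_mem_Icc.2 zero_le_one)).symm, ?_⟩)
    rw [snd_pair hr (right_mem_Icc.2 zero_le_one)]
    exact x.snd_mem.2

theorem pair_self {q : Icc (0 : ℚ) 1} (h : (0 : ℝ) < ((q : ℚ) : ℝ)) :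
    pair ((q : ℚ) : ℝ) ((q : ℚ) : ℝ) = hat q :=
  pair_fst_snd (x := hat q) h

end TruthValue

/-! ### Nonstandard truth values and their embedding into the standard ones. -/

/-- Nonstandard truth values. -/
abbrev HyperTruth : Type := Germ (hyperfilter ℕ : Filter ℕ) TruthValue

namespace HyperTruth

/-- The first coordinate of the nonstandard truth value `x` is the standard real `r`. -/
def HasFst (x : HyperTruth) (r : ℝ) : Prop := x.LiftPred fun t => t.fst = r

theorem hasFst_const {t : TruthValue} {r : ℝ} : HasFst (↑t) r ↔ t.fst = r :=
  Germ.liftPred_const_iff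

variable {x y : HyperTruth} {r s : ℝ}

theorem HasFst.unique (h1 : HasFst x r) (h2 : HasFst x s) : r = s := by
  induction x using Germ.inductionOn with | _ v
  obtain ⟨j, h, h'⟩ := (Eventually.and h1 h2).exists
  exact h.symm.trans h'

theorem HasFst.mem_Icc (h : HasFst x r) : r ∈ Icc (0 : ℝ) 1 := by
  induction x using Germ.inductionOn with | _ v
  obtain ⟨j, rfl⟩ := Eventually.exists h
  exact fst_mem _

theorem HasFst.lt (h1 : HasFst x r) (h2 : HasFst y s) (h : r < s) : x < y := by
  induction x using Germ.inductionOn with | _ v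
  induction y using Germ.inductionOn with | _ w
  refine Germ.coe_lt.2 ?_
  filter_upwards [h1, h2] with j hj hj'
  exact lt_of_fst_lt (by rwa [hj, hj'])

theorem HasFst.le_of_le (h1 : HasFst x r) (h2 : HasFst y s) (h : x ≤ y) : r ≤ s :=
  le_of_not_gt fun h' => (h2.lt h1 h').not_ge h

theorem HasFst.eq_bot (h : HasFst x 0) : x = ↑(⊥ : TruthValue) := by
  induction x using Germ.inductionOn with | _ v
  exact Germ.coe_eq.2 (Eventually.mono h fun j hj => eq_bot_of_fst hj)

theorem HasFst.pair_zero_le (h : HasFst x r) : ↑(pair r 0) ≤ x := by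
  induction x using Germ.inductionOn with | _ v
  exact Eventually.mono h fun j hj => TruthValue.pair_zero_le hj

theorem HasFst.le_pair_one (h : HasFst x r) : x ≤ ↑(pair r 1) := by
  induction x using Germ.inductionOn with | _ v
  exact Eventually.mono h fun j hj => TruthValue.le_pair_one hj


/-- A set of nonstandard truth values with the same standard first coordinate `r` whose elements are
separated by countably many upper sets embeds into `[0,1]`, preserving suprema and infima as well
as the second coordinates of `(r, 0)`, `(r, 1)` and `(r, r)`. -/
theorem exists_fiber_embedding {ι : Type*} [Countable ι] {D : Set HyperTruth} {r : ℝ}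
    (hr : r ∈ Ioc (0 : ℝ) 1) (hD : ∀ x ∈ D, HasFst x r) (U : ι → Set HyperTruth)
    (hU : ∀ i, IsUpperSet (U i)) (hsep : ∀ x ∈ D, ∀ y ∈ D, x < y → ∃ i, x ∉ U i ∧ y ∈ U i) :
    ∃ g : HyperTruth → ℝ, StrictMonoOn g D ∧ (∀ x ∈ D, g x ∈ Icc (0 : ℝ) 1) ∧
      (↑(pair r 0) ∈ D → g ↑(pair r 0) = 0) ∧ (↑(pair r 1) ∈ D → g ↑(pair r 1) = 1) ∧
      (↑(pair r r) ∈ D → g ↑(pair r r) = r) ∧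
      (∀ B ⊆ D, B.Nonempty → ∀ u ∈ D, (∀ b ∈ B, b ≤ u) →
        (∀ x ∈ D, (∀ b ∈ B, b ≤ x) → u ≤ x) → IsLUB (g '' B) (g u)) ∧
      (∀ B ⊆ D, B.Nonempty → ∀ u ∈ D, (∀ b ∈ B, u ≤ b) →
        (∀ x ∈ D, (∀ b ∈ B, x ≤ b) → x ≤ u) → IsGLB (g '' B) (g u)) := by
  classical
  set lo : HyperTruth := ↑(pair r 0) with hlo
  set hi : HyperTruth := ↑(pair r 1) with hhi
  -- The end points are adjoined so that the embedding can be normalised even when `D` lacks them.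
  let X : Set HyperTruth := D ∪ {lo, hi}
  have h0 : (0 : ℝ) ∈ Icc (0 : ℝ) 1 := left_mem_Icc.2 zero_le_one
  have h1 : (1 : ℝ) ∈ Icc (0 : ℝ) 1 := right_mem_Icc.2 zero_le_one
  have hX : ∀ x ∈ X, HasFst x r := by
    rintro x (hx | rfl | rfl)
    · exact hD x hx
    · exact hasFst_const.2 (fst_pair hr h0)
    · exact hasFst_const.2 (fst_pair hr h1)
  have hloX : lo ∈ X := Or.inr (Or.inl rfl)
  have hhiX : hi ∈ X := Or.inr (Or.inr rfl)
  have hpair : ∀ {s t : ℝ}, s ∈ Icc (0 : ℝ) 1 → t ∈ Icc (0 : ℝ) 1 → s < t →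
      (↑(pair r s) : HyperTruth) < ↑(pair r t) := fun hs ht hst =>
    Germ.const_lt (lt_iff.2 (Or.inr ⟨(fst_pair hr hs).trans (fst_pair hr ht).symm, by
      rwa [snd_pair hr hs, snd_pair hr ht]⟩))
  let V : Option (Option ι) → Set X := fun i => match i with
    | none => Ioi ⟨lo, hloX⟩
    | some none => Ici ⟨hi, hhiX⟩
    | some (some i) => Subtype.val ⁻¹' U i
  have hV : ∀ i, IsUpperSet (V i) := by
    rintro (_ | _ | i)
    · exact isUpperSet_Ioi _
    · exact isUpperSet_Ici _
    · exact fun x y hxy hx => hU i hxy hx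
  have hVsep : ∀ x y : X, x < y → ∃ i, x ∉ V i ∧ y ∈ V i := by
    rintro ⟨x, hx⟩ ⟨y, hy⟩ (hxy : x < y)
    rcases hx with hx | rfl | rfl
    · rcases hy with hy | rfl | rfl
      · obtain ⟨i, hi⟩ := hsep x hx y hy hxy
        exact ⟨some (some i), hi⟩
      · exact absurd (hD x hx).pair_zero_le hxy.not_ge
      · exact ⟨some none, fun h : hi ≤ x => hxy.not_ge h, le_refl hi⟩
    · exact ⟨none, lt_irrefl lo, hxy⟩
    · exact absurd (hX y hy).le_pair_one hxy.not_ge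
  -- The point to be normalised is `(r, r)`. If it is absent from `D`, or if `r = 1` and it is the
  -- top, the choice `c = hi`, `t = 1` imposes nothing new.
  obtain ⟨c, t, hc, ht0, ht, hct⟩ : ∃ (c : X) (t : ℝ), lo < c ∧ 0 < t ∧
      (c < (⟨hi, hhiX⟩ : X) ∧ t < 1 ∨ c = ⟨hi, hhiX⟩ ∧ t = 1) ∧
      (↑(pair r r) ∈ D → ↑(pair r r) = (c : HyperTruth) ∧ t = r) := by
    by_cases h : ↑(pair r r) ∈ D ∧ r < 1
    · exact ⟨⟨_, Or.inl h.1⟩, r, hpair h0 ⟨hr.1.le, hr.2⟩ hr.1, hr.1,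
        Or.inl ⟨hpair ⟨hr.1.le, hr.2⟩ h1 h.2, h.2⟩, fun _ => ⟨rfl, rfl⟩⟩
    · refine ⟨⟨hi, hhiX⟩, 1, hpair h0 h1 one_pos, one_pos, Or.inr ⟨rfl, rfl⟩, fun h' => ?_⟩
      have : r = 1 := le_antisymm hr.2 (not_lt.1 fun hlt => h ⟨h', hlt⟩)
      exact ⟨by rw [this] at hhi ⊢; exact hhi.symm, this.symm⟩
  obtain ⟨g, hg, hg0, hg1, hgc, hlub, hglb⟩ := exists_strictMono_unitInterval V hV hVsep
    (a := ⟨lo, hloX⟩) (b := ⟨hi, hhiX⟩) (fun x => (hX x x.2).pair_zero_le) hc ht0 ht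
  let G : HyperTruth → ℝ := fun x => if h : x ∈ X then g ⟨x, h⟩ else 0
  have hG : ∀ x (h : x ∈ X), G x = g ⟨x, h⟩ := fun x h => dif_pos h
  have himage : ∀ B ⊆ D, G '' B = g '' (Subtype.val ⁻¹' B) := fun B hB => by
    ext z
    constructor
    · rintro ⟨b, hb, rfl⟩
      exact ⟨⟨b, Or.inl (hB hb)⟩, hb, (hG _ _).symm⟩
    · rintro ⟨⟨b, hbX⟩, hb, rfl⟩
      exact ⟨b, hb, hG _ _⟩
  refine ⟨G, fun x hx y hy hxy => ?_, fun x hx => ?_, fun _ => (hG _ hloX).trans hg0,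
    fun _ => (hG _ hhiX).trans hg1, fun h => ?_, fun B hB hne u hu hub hleast => ?_,
    fun B hB hne u hu hub hleast => ?_⟩
  · rw [hG x (Or.inl hx), hG y (Or.inl hy)]
    exact hg hxy
  · rw [hG x (Or.inl hx), ← hg0, ← hg1]
    exact ⟨hg.monotone (hD x hx).pair_zero_le, hg.monotone (hD x hx).le_pair_one⟩
  · exact (hG _ (Or.inl h)).trans
      ((congrArg g (Subtype.ext (hct h).1)).trans (hgc.trans (hct h).2))
  · rw [himage B hB, hG u (Or.inl hu)]
    obtain ⟨b, hb⟩ := hne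
    refine hlub _ _ ⟨⟨b, Or.inl (hB hb)⟩, hb⟩ ⟨fun z hz => hub z hz, ?_⟩
    rintro ⟨x, hx⟩ hxB
    have hxB' : ∀ b ∈ B, b ≤ x := fun b hb => hxB (a := ⟨b, Or.inl (hB hb)⟩) hb
    rcases hx with hx | rfl | rfl
    · exact hleast x hx hxB'
    -- If the adjoined bottom bounds `B`, then so does any `b ∈ B`, which lies in `D`; hence `u ≤ b
    -- ≤ lo`.
    · exact (hleast b (hB hb) fun b' hb' =>
        (hxB' b' hb').trans (hD b (hB hb)).pair_zero_le).trans (hxB' b hb)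
    · exact (hD u hu).le_pair_one
  · rw [himage B hB, hG u (Or.inl hu)]
    obtain ⟨b, hb⟩ := hne
    refine hglb _ _ ⟨⟨b, Or.inl (hB hb)⟩, hb⟩ ⟨fun z hz => hub z hz, ?_⟩
    rintro ⟨x, hx⟩ hxB
    have hxB' : ∀ b ∈ B, x ≤ b := fun b hb => hxB (a := ⟨b, Or.inl (hB hb)⟩) hb
    rcases hx with hx | rfl | rfl
    · exact hleast x hx hxB'
    · exact (hD u hu).pair_zero_le
    · exact (hxB' b hb).trans (hleast b (hB hb) fun b' hb' =>
        (hD b (hB hb)).le_pair_one.trans (hxB' b' hb'))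

/-- `G` embeds the set `D` of nonstandard truth values into the standard ones. -/
structure IsRealization (D : Set HyperTruth) (G : HyperTruth → TruthValue) : Prop where
  fst_eq : ∀ {x r}, x ∈ D → HasFst x r → (G x).fst = r
  strictMonoOn : StrictMonoOn G D
  map_hat : ∀ q : Icc (0 : ℚ) 1, ↑(hat q) ∈ D → G ↑(hat q) = hat q
  map_pair_zero : ∀ {r}, r ∈ Ioc (0 : ℝ) 1 → ↑(pair r 0) ∈ D → G ↑(pair r 0) = pair r 0
  map_pair_one : ∀ {r}, r ∈ Ioc (0 : ℝ) 1 → ↑(pair r 1) ∈ D → G ↑(pair r 1) = pair r 1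
  le_of_isLUB : ∀ {r}, ∀ B ⊆ D, B.Nonempty → (∀ b ∈ B, HasFst b r) → ∀ u ∈ D, HasFst u r →
    (∀ b ∈ B, b ≤ u) → (∀ x ∈ D, HasFst x r → (∀ b ∈ B, b ≤ x) → u ≤ x) →
    ∀ y : TruthValue, y.fst = r → (∀ b ∈ B, G b ≤ y) → G u ≤ y
  le_of_isGLB : ∀ {r}, ∀ B ⊆ D, B.Nonempty → (∀ b ∈ B, HasFst b r) → ∀ u ∈ D, HasFst u r →
    (∀ b ∈ B, u ≤ b) → (∀ x ∈ D, HasFst x r → (∀ b ∈ B, x ≤ b) → x ≤ u) →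
    ∀ y : TruthValue, y.fst = r → (∀ b ∈ B, y ≤ G b) → y ≤ G u

/-- The fibres can be embedded independently, since the lexicographic order compares different
fibres by first coordinates alone. The fibre over `0` contains at most `⊥`. -/
theorem exists_isRealization {ι : Type*} [Countable ι] {D : Set HyperTruth}
    (hD : ∀ x ∈ D, ∃ r, HasFst x r) (U : ℝ → ι → Set HyperTruth)
    (hU : ∀ r i, IsUpperSet (U r i))
    (hsep : ∀ r, ∀ x ∈ D, HasFst x r → ∀ y ∈ D, HasFst y r → x < y →
      ∃ i, x ∉ U r i ∧ y ∈ U r i) :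
    ∃ G, IsRealization D G := by
  classical
  have key : ∀ r : Ioc (0 : ℝ) 1, _ := fun r =>
    exists_fiber_embedding (D := {x ∈ D | HasFst x r}) r.2 (fun x hx => hx.2) (U r) (hU r)
      fun x hx y hy => hsep r x hx.1 hx.2 y hy.1 hy.2
  choose g hg hgI hg0 hg1 hgr hlub hglb using key
  choose! φ hφ using hD
  let G : HyperTruth → TruthValue := fun x =>
    if h : φ x ∈ Ioc (0 : ℝ) 1 then pair (φ x) (g ⟨φ x, h⟩ x) else ⊥
  have hφ' : ∀ {x r}, x ∈ D → HasFst x r → φ x = r := fun hx hr => (hφ _ hx).unique hr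
  have hG : ∀ {x r}, x ∈ D → HasFst x r → ∀ hr : r ∈ Ioc (0 : ℝ) 1,
      G x = pair r (g ⟨r, hr⟩ x) := fun {x r} hx hxr hr => by
    obtain rfl := hφ' hx hxr
    exact dif_pos hr
  have hfst : ∀ {x r}, x ∈ D → HasFst x r → (G x).fst = r := fun {x r} hx hxr => by
    rcases hxr.mem_Icc.1.eq_or_lt with rfl | h0
    · have : ¬ φ x ∈ Ioc (0 : ℝ) 1 := fun h => h.1.ne' (hφ' hx hxr)
      simp only [G, dif_neg this, fst_bot]
    · have hr : r ∈ Ioc (0 : ℝ) 1 := ⟨h0, hxr.mem_Icc.2⟩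
      rw [hG hx hxr hr]
      exact fst_pair hr (hgI ⟨r, hr⟩ x ⟨hx, hxr⟩)
  have hsnd : ∀ {x r}, x ∈ D → HasFst x r → ∀ hr : r ∈ Ioc (0 : ℝ) 1,
      (G x).snd = g ⟨r, hr⟩ x := fun {x r} hx hxr hr => by
    rw [hG hx hxr hr]
    exact snd_pair hr (hgI ⟨r, hr⟩ x ⟨hx, hxr⟩)
  have hbot : ∀ {y : TruthValue} {r : ℝ} {u : HyperTruth}, u ∈ D → HasFst u r → y.fst = r →
      ¬ 0 < r → G u = y := fun {y r u} hu hur hy h0 => by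
    have hr0 : r = 0 := le_antisymm (not_lt.1 h0) hur.mem_Icc.1
    rw [eq_bot_of_fst (hy.trans hr0), eq_bot_of_fst ((hfst hu hur).trans hr0)]
  have h0 : (0 : ℝ) ∈ Icc (0 : ℝ) 1 := left_mem_Icc.2 zero_le_one
  have h1 : (1 : ℝ) ∈ Icc (0 : ℝ) 1 := right_mem_Icc.2 zero_le_one
  refine ⟨G, hfst, fun x hx y hy hxy => ?_, fun q hq => ?_, fun {r} hr h => ?_,
    fun {r} hr h => ?_, fun {r} B hB hne hBr u hu hur hub hleast y hy hyB => ?_,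
    fun {r} B hB hne hBr u hu hur hub hleast y hy hyB => ?_⟩
  · rcases ((hφ x hx).le_of_le (hφ y hy) hxy.le).lt_or_eq with h | h
    · exact lt_of_fst_lt (by rwa [hfst hx (hφ x hx), hfst hy (hφ y hy)])
    · refine lt_iff.2 (Or.inr ⟨by rw [hfst hx (hφ x hx), hfst hy (hφ y hy), h], ?_⟩)
      have hy' : HasFst y (φ x) := h ▸ hφ y hy
      have h0 : 0 < φ x := (hφ x hx).mem_Icc.1.lt_of_ne fun h0 => by
        have e1 := (h0 ▸ hφ x hx : HasFst x 0).eq_bot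
        have e2 := (h0 ▸ hy' : HasFst y 0).eq_bot
        exact hxy.ne (e1.trans e2.symm)
      have hr : φ x ∈ Ioc (0 : ℝ) 1 := ⟨h0, (hφ x hx).mem_Icc.2⟩
      rw [hsnd hx (hφ x hx) hr, hsnd hy hy' hr]
      exact hg _ ⟨hx, hφ x hx⟩ ⟨hy, hy'⟩ hxy
  · have hf : HasFst (↑(hat q)) ((q : ℚ) : ℝ) := hasFst_const.2 rfl
    by_cases h0 : (0 : ℝ) < ((q : ℚ) : ℝ)
    · have hr : ((q : ℚ) : ℝ) ∈ Ioc (0 : ℝ) 1 := ⟨h0, hf.mem_Icc.2⟩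
      refine ext (hfst hq hf) ((hsnd hq hf hr).trans ?_)
      have := hgr ⟨_, hr⟩
      rw [pair_self h0] at this
      exact this ⟨hq, hf⟩
    · exact hbot hq hf rfl h0
  · have hf : HasFst (↑(pair r 0)) r := hasFst_const.2 (fst_pair hr h0)
    exact ext ((hfst h hf).trans (fst_pair hr h0).symm)
      ((hsnd h hf hr).trans ((hg0 ⟨r, hr⟩ ⟨h, hf⟩).trans (snd_pair hr h0).symm))
  · have hf : HasFst (↑(pair r 1)) r := hasFst_const.2 (fst_pair hr h1)
    exact ext ((hfst h hf).trans (fst_pair hr h1).symm)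
      ((hsnd h hf hr).trans ((hg1 ⟨r, hr⟩ ⟨h, hf⟩).trans (snd_pair hr h1).symm))
  · by_cases h0 : 0 < r
    · have hr : r ∈ Ioc (0 : ℝ) 1 := ⟨h0, hur.mem_Icc.2⟩
      refine le_iff.2 (Or.inr ⟨(hfst hu hur).trans hy.symm, ?_⟩)
      rw [hsnd hu hur hr]
      refine (hlub ⟨r, hr⟩ B (fun b hb => ⟨hB hb, hBr b hb⟩) hne u ⟨hu, hur⟩ hub
        fun x hx => hleast x hx.1 hx.2).2 ?_
      rintro _ ⟨b, hb, rfl⟩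
      rw [← hsnd (hB hb) (hBr b hb) hr]
      rcases le_iff.1 (hyB b hb) with h | h
      · exact absurd h (by rw [hfst (hB hb) (hBr b hb), hy]; exact lt_irrefl r)
      · exact h.2
    · exact (hbot hu hur hy h0).le
  · by_cases h0 : 0 < r
    · have hr : r ∈ Ioc (0 : ℝ) 1 := ⟨h0, hur.mem_Icc.2⟩
      refine le_iff.2 (Or.inr ⟨hy.trans (hfst hu hur).symm, ?_⟩)
      rw [hsnd hu hur hr]
      refine (hglb ⟨r, hr⟩ B (fun b hb => ⟨hB hb, hBr b hb⟩) hne u ⟨hu, hur⟩ hub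
        fun x hx => hleast x hx.1 hx.2).2 ?_
      rintro _ ⟨b, hb, rfl⟩
      rw [← hsnd (hB hb) (hBr b hb) hr]
      rcases le_iff.1 (hyB b hb) with h | h
      · exact absurd h (by rw [hfst (hB hb) (hBr b hb), hy]; exact lt_irrefl r)
      · exact h.2
    · exact (hbot hu hur hy h0).ge

namespace IsRealization

variable {D : Set HyperTruth} {G : HyperTruth → TruthValue}

/-- By `happrox` the supremum of the images has first coordinate at least `r`. If it equals `r`,
either some `b m` lies in the fibre over `r`, and only such members matter, or `hlim` puts `u` at
the bottom of that fibre. -/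
theorem map_iSup (hG : IsRealization D G) (hD : ∀ x ∈ D, ∃ r, HasFst x r) {N : Type*}
    {b : N → HyperTruth} (hb : ∀ m, b m ∈ D) {u : HyperTruth} (hu : u ∈ D) {r : ℝ}
    (hur : HasFst u r) (hub : ∀ m, b m ≤ u) (hleast : ∀ x ∈ D, (∀ m, b m ≤ x) → u ≤ x)
    (hlim : (∀ m, ¬ HasFst (b m) r) → u = ↑(pair r 0))
    (happrox : ∀ q : Icc (0 : ℚ) 1, ((q : ℚ) : ℝ) < r →
      ∃ m s, HasFst (b m) s ∧ ((q : ℚ) : ℝ) < s) :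
    G u = ⨆ m, G (b m) := by
  refine le_antisymm ?_ (iSup_le fun m => hG.strictMonoOn.monotoneOn (hb m) hu (hub m))
  set y := ⨆ m, G (b m) with hy
  have hyb : ∀ m, G (b m) ≤ y := le_iSup fun m => G (b m)
  have hyr : r ≤ y.fst := le_of_not_gt fun h => by
    obtain ⟨q, hq1, hq2⟩ := exists_hat_between y.fst_mem.1 hur.mem_Icc.2 h
    obtain ⟨m, s, hs, hqs⟩ := happrox q hq2
    have := fst_mono (hyb m)
    rw [hG.fst_eq (hb m) hs] at this
    linarith
  rcases hyr.lt_or_eq with h | h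
  · exact (lt_of_fst_lt (by rwa [hG.fst_eq hu hur])).le
  · by_cases hex : ∃ m, HasFst (b m) r
    · obtain ⟨m, hm⟩ := hex
      refine hG.le_of_isLUB (range b ∩ {x | HasFst x r}) ?_ ⟨b m, ⟨m, rfl⟩, hm⟩
        (fun _ h => h.2) u hu hur ?_ ?_ y h.symm ?_
      · rintro _ ⟨⟨m, rfl⟩, -⟩
        exact hb m
      · rintro _ ⟨⟨m, rfl⟩, -⟩
        exact hub m
      · intro x hx hxr hxB
        refine hleast x hx fun m' => ?_
        obtain ⟨s, hs⟩ := hD _ (hb m')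
        rcases (hs.le_of_le hur (hub m')).lt_or_eq with h | rfl
        · exact (hs.lt hxr h).le
        · exact hxB _ ⟨⟨m', rfl⟩, hs⟩
      · rintro _ ⟨⟨m, rfl⟩, -⟩
        exact hyb m
    · have hu0 := hlim (not_exists.1 hex)
      by_cases hr : r ∈ Ioc (0 : ℝ) 1
      · rw [hu0, hG.map_pair_zero hr (hu0 ▸ hu)]
        exact TruthValue.pair_zero_le h.symm
      · have hr0 : r = 0 := le_antisymm (not_lt.1 fun h0 => hr ⟨h0, hur.mem_Icc.2⟩) hur.mem_Icc.1
        rw [eq_bot_of_fst ((hG.fst_eq hu hur).trans hr0)]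
        exact bot_le

theorem map_iInf (hG : IsRealization D G) (hD : ∀ x ∈ D, ∃ r, HasFst x r) {N : Type*}
    {b : N → HyperTruth} (hb : ∀ m, b m ∈ D) {u : HyperTruth} (hu : u ∈ D) {r : ℝ}
    (hur : HasFst u r) (hlb : ∀ m, u ≤ b m) (hgreatest : ∀ x ∈ D, (∀ m, x ≤ b m) → x ≤ u)
    (hlim : (∀ m, ¬ HasFst (b m) r) → u = ↑(pair r 1))
    (happrox : ∀ q : Icc (0 : ℚ) 1, r < ((q : ℚ) : ℝ) →
      ∃ m s, HasFst (b m) s ∧ s < ((q : ℚ) : ℝ)) :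
    G u = ⨅ m, G (b m) := by
  refine le_antisymm (le_iInf fun m => hG.strictMonoOn.monotoneOn hu (hb m) (hlb m)) ?_
  set y := ⨅ m, G (b m) with hy
  have hyb : ∀ m, y ≤ G (b m) := iInf_le fun m => G (b m)
  have hyr : y.fst ≤ r := le_of_not_gt fun h => by
    obtain ⟨q, hq1, hq2⟩ := exists_hat_between hur.mem_Icc.1 y.fst_mem.2 h
    obtain ⟨m, s, hs, hqs⟩ := happrox q hq1
    have := fst_mono (hyb m)
    rw [hG.fst_eq (hb m) hs] at this
    linarith
  rcases hyr.lt_or_eq with h | h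
  · exact (lt_of_fst_lt (by rwa [hG.fst_eq hu hur])).le
  · by_cases hex : ∃ m, HasFst (b m) r
    · obtain ⟨m, hm⟩ := hex
      refine hG.le_of_isGLB (range b ∩ {x | HasFst x r}) ?_ ⟨b m, ⟨m, rfl⟩, hm⟩
        (fun _ h => h.2) u hu hur ?_ ?_ y h ?_
      · rintro _ ⟨⟨m, rfl⟩, -⟩
        exact hb m
      · rintro _ ⟨⟨m, rfl⟩, -⟩
        exact hlb m
      · intro x hx hxr hxB
        refine hgreatest x hx fun m' => ?_
        obtain ⟨s, hs⟩ := hD _ (hb m')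
        rcases (hur.le_of_le hs (hlb m')).lt_or_eq with h | rfl
        · exact (hxr.lt hs h).le
        · exact hxB _ ⟨⟨m', rfl⟩, hs⟩
      · rintro _ ⟨⟨m, rfl⟩, -⟩
        exact hyb m
    · have hu0 := hlim (not_exists.1 hex)
      by_cases hr : r ∈ Ioc (0 : ℝ) 1
      · rw [hu0, hG.map_pair_one hr (hu0 ▸ hu)]
        exact TruthValue.le_pair_one h
      · have hr0 : r = 0 := le_antisymm (not_lt.1 fun h0 => hr ⟨h0, hur.mem_Icc.2⟩) hur.mem_Icc.1
        rw [eq_bot_of_fst (h.trans hr0)]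
        exact bot_le

end IsRealization

end HyperTruth

end UML

/-! ### Renaming of variables, truth degrees, and what weak elementary embeddings preserve. -/

namespace UML

open Filter Set TruthValue

namespace Formula

variable {L : FirstOrder.Language.{u, v}}

/-- The variables that occur in a formula. -/
def vars : Formula L → Finset ℕ
  | .const _ => ∅
  | .pred _ t => Finset.univ.biUnion fun i => (t i).varFinset
  | .and φ ψ => φ.vars ∪ ψ.vars
  | .imp φ ψ => φ.vars ∪ ψ.vars
  | .all _ φ => φ.vars
  | .ex _ φ => φ.vars

/-- Rename all variables, free and bound. -/
def rename (e : ℕ → ℕ) : Formula L → Formula L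
  | .const r => .const r
  | .pred P t => .pred P fun i => (t i).relabel e
  | .and φ ψ => .and (φ.rename e) (ψ.rename e)
  | .imp φ ψ => .imp (φ.rename e) (ψ.rename e)
  | .all x φ => .all (e x) (φ.rename e)
  | .ex x φ => .ex (e x) (φ.rename e)

end Formula

namespace GodelStructure

variable {L : FirstOrder.Language.{u, v}} {M : Type w} (S : GodelStructure L M)

theorem termVal_congr {σ τ : ℕ → M} (t : L.Term ℕ) (h : ∀ n ∈ t.varFinset, σ n = τ n) :
    S.termVal σ t = S.termVal τ t := by
  induction t with
  | var x => exact h x (Finset.mem_singleton_self x)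
  | func f t ih =>
    simp only [termVal]
    congr 1
    ext i
    exact ih i fun n hn => h n (Finset.mem_biUnion.2 ⟨i, Finset.mem_univ i, hn⟩)

theorem val_congr (φ : Formula L) {σ τ : ℕ → M} (h : ∀ n ∈ φ.vars, σ n = τ n) :
    S.val φ σ = S.val φ τ := by
  have hupd : ∀ {s : Finset ℕ} {σ τ : ℕ → M} (x : ℕ) (a : M), (∀ n ∈ s, σ n = τ n) →
      ∀ n ∈ s, Function.update σ x a n = Function.update τ x a n := by
    intro s σ τ x a h n hn
    by_cases hx : n = x
    · simp [hx]
    · simp [hx, h n hn]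
  induction φ generalizing σ τ with
  | const r => rfl
  | pred P t =>
    simp only [val]
    congr 1
    ext i
    exact S.termVal_congr (t i) fun n hn =>
      h n (Finset.mem_biUnion.2 ⟨i, Finset.mem_univ i, hn⟩)
  | and φ ψ ih1 ih2 =>
    simp only [val]
    rw [ih1 fun n hn => h n (Finset.mem_union_left _ hn),
      ih2 fun n hn => h n (Finset.mem_union_right _ hn)]
  | imp φ ψ ih1 ih2 =>
    simp only [val]
    rw [ih1 fun n hn => h n (Finset.mem_union_left _ hn),
      ih2 fun n hn => h n (Finset.mem_union_right _ hn)]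
  | all x φ ih => exact iSup_congr fun a => ih (hupd x a h)
  | ex x φ ih => exact iInf_congr fun a => ih (hupd x a h)

theorem termVal_relabel (e : ℕ → ℕ) (σ : ℕ → M) (t : L.Term ℕ) :
    S.termVal σ (t.relabel e) = S.termVal (σ ∘ e) t := by
  induction t with
  | var x => rfl
  | func f t ih =>
    simp only [FirstOrder.Language.Term.relabel, termVal]
    congr 1
    ext i
    exact ih i

/-- Bound variables are renamed too, and injectivity of `e` rules out capture. -/
theorem val_rename {e : ℕ → ℕ} (he : Function.Injective e) (φ : Formula L) (σ : ℕ → M) :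
    S.val (φ.rename e) σ = S.val φ (σ ∘ e) := by
  induction φ generalizing σ with
  | const r => rfl
  | pred P t =>
    simp only [Formula.rename, val, termVal_relabel]
  | and φ ψ ih1 ih2 => simp only [Formula.rename, val, ih1, ih2]
  | imp φ ψ ih1 ih2 => simp only [Formula.rename, val, ih1, ih2]
  | all x φ ih =>
    simp only [Formula.rename, val, ih, Function.update_comp_eq_of_injective _ he]
  | ex x φ ih =>
    simp only [Formula.rename, val, ih, Function.update_comp_eq_of_injective _ he]

theorem satisfies_const_imp_iff (r : Icc (0 : ℚ) 1) (φ : Formula L) (σ : ℕ → M) :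
    S.Satisfies (.imp (.const r) φ) σ ↔ S.val φ σ ≤ hat r :=
  imp_eq_bot_iff

/-- The truth degree is the first coordinate of the truth value. -/
theorem truthDegree_eq_fst (φ : Formula L) (σ : ℕ → M) :
    S.truthDegree φ σ = (S.val φ σ).fst := by
  set x := S.val φ σ with hx
  have hbdd : x.fst ∈ lowerBounds {y : ℝ | ∃ r : Icc (0 : ℚ) 1,
      y = ((r : ℚ) : ℝ) ∧ S.Satisfies (.imp (.const r) φ) σ} := by
    rintro _ ⟨r, rfl, hr⟩
    exact fst_mono ((S.satisfies_const_imp_iff r φ σ).1 hr)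
  refine le_antisymm (le_of_forall_gt fun y hy => ?_) (le_csInf ?_ hbdd)
  · by_cases hy1 : y ≤ 1
    · obtain ⟨q, hq1, hq2⟩ := exists_hat_between x.fst_mem.1 hy1 hy
      exact (csInf_le ⟨_, hbdd⟩ ⟨q, rfl, (S.satisfies_const_imp_iff q φ σ).2
        (lt_of_fst_lt hq1).le⟩).trans_lt hq2
    · exact (csInf_le ⟨_, hbdd⟩ ⟨1, rfl, (S.satisfies_const_imp_iff 1 φ σ).2
        (le_hat_one x)⟩).trans_lt (by simpa using hy1)
  · exact ⟨_, 1, rfl, (S.satisfies_const_imp_iff 1 φ σ).2 (le_hat_one x)⟩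

end GodelStructure

namespace WeakElementaryEmbedding

variable {L : UltrametricLanguage.{u, v}} {M : Type w} {N : Type w'}
  {S : UltrametricStructure L M} {T : UltrametricStructure L N}

theorem fst_val (j : WeakElementaryEmbedding S T) (φ : Formula L.lang) (σ : ℕ → M) :
    (T.val φ (j ∘ σ)).fst = (S.val φ σ).fst := by
  rw [← GodelStructure.truthDegree_eq_fst, ← GodelStructure.truthDegree_eq_fst]
  exact (j.truthDegree_eq φ σ).symm

/-- The inequality says that `ψ → φ` has truth degree `0`. As the two assignments may differ, the
variables of `φ` are first moved to even and those of `ψ` to odd indices, so that one assignment `ρ`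
serves both. -/
theorem val_le_val_iff (j : WeakElementaryEmbedding S T) (φ ψ : Formula L.lang) (σ τ : ℕ → M) :
    T.val φ (j ∘ σ) ≤ T.val ψ (j ∘ τ) ↔ S.val φ σ ≤ S.val ψ τ := by
  let e₀ : ℕ → ℕ := fun n => 2 * n
  let e₁ : ℕ → ℕ := fun n => 2 * n + 1
  have he₀ : Function.Injective e₀ := fun a b h => by simp only [e₀] at h; omega
  have he₁ : Function.Injective e₁ := fun a b h => by simp only [e₁] at h; omega
  let ρ : ℕ → M := fun n => if n % 2 = 0 then σ (n / 2) else τ (n / 2)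
  have hρ₀ : ρ ∘ e₀ = σ := by
    ext n
    simp [ρ, e₀]
  have hρ₁ : ρ ∘ e₁ = τ := by
    ext n
    simp only [ρ, e₁, Function.comp_apply]
    rw [if_neg (by omega)]
    congr 1
    omega
  have h := j.fst_val (.imp (ψ.rename e₁) (φ.rename e₀)) ρ
  simp only [GodelStructure.val, GodelStructure.val_rename _ he₀, GodelStructure.val_rename _ he₁,
    Function.comp_assoc, hρ₀, hρ₁] at h
  rw [← imp_eq_bot_iff, ← imp_eq_bot_iff, ← fst_eq_zero_iff, ← fst_eq_zero_iff, h]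

theorem map_funMap (j : WeakElementaryEmbedding S T) {k : ℕ} (f : L.lang.Functions k)
    (a : Fin k → M) : j (S.funMap f a) = T.funMap f (j ∘ a) :=
  j.map_fun f a

/-- If the images coincide, the distance of `a` and `b` has first coordinate `0` and is therefore
`0̂`. -/
theorem injective (j : WeakElementaryEmbedding S T) : Function.Injective j := by
  intro a b hab
  let t : Fin 2 → L.lang.Term ℕ := fun i => .var i
  let σ : ℕ → M := fun n => if n = 0 then a else b
  have hS : S.val (.pred L.d t) σ = S.relMap L.d ![a, b] := by
    simp only [GodelStructure.val, GodelStructure.termVal, t, σ]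
    congr 1
    ext i
    fin_cases i <;> rfl
  have hT : T.val (.pred L.d t) (j ∘ σ) = T.relMap L.d ![j a, j b] := by
    simp only [GodelStructure.val, GodelStructure.termVal, t, σ]
    congr 1
    ext i
    fin_cases i <;> rfl
  refine S.eq_of_d_eq a b ?_
  have h := j.fst_val (.pred L.d t) σ
  rw [hS, hT, hab, T.d_self, hat_zero, fst_bot] at h
  exact eq_bot_of_fst h.symm

end WeakElementaryEmbedding

/-! ### Values along a chain and their germs. -/

/-- A set `N` exhausted by the images of a chain of structures under compatible injections. -/
structure ChainCocone {L : UltrametricLanguage.{u, v}} {M : ℕ → Type w}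
    (S : ∀ i, UltrametricStructure L (M i)) (N : Type w') where
  /-- The embeddings of the chain. -/
  f : ∀ i j : ℕ, i ≤ j → WeakElementaryEmbedding (S i) (S j)
  /-- The injections into `N`. -/
  h : ∀ i, M i → N
  h_comp : ∀ i j hij x, h j (f i j hij x) = h i x
  injective : ∀ i, Function.Injective (h i)
  exhaust : ∀ n, ∃ i, n ∈ range (h i)

namespace ChainCocone

variable {L : UltrametricLanguage.{u, v}} {M : ℕ → Type w}
  {S : ∀ i, UltrametricStructure L (M i)} {N : Type w'} (C : ChainCocone S N)

/-- A left inverse of the injection `h i`. -/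
noncomputable def rep (i : ℕ) : N → M i :=
  haveI := (S i).nonempty
  Function.invFun (C.h i)

theorem rep_h (i : ℕ) (x : M i) : C.rep i (C.h i x) = x :=
  haveI := (S i).nonempty
  Function.leftInverse_invFun (C.injective i) x

theorem h_rep {i : ℕ} {n : N} (hn : n ∈ range (C.h i)) : C.h i (C.rep i n) = n := by
  obtain ⟨x, rfl⟩ := hn
  rw [rep_h]

theorem range_mono {i j : ℕ} (hij : i ≤ j) : range (C.h i) ⊆ range (C.h j) := by
  rintro _ ⟨x, rfl⟩
  exact ⟨C.f i j hij x, C.h_comp i j hij x⟩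

theorem rep_of_le {i j : ℕ} (hij : i ≤ j) {n : N} (hn : n ∈ range (C.h i)) :
    C.rep j n = C.f i j hij (C.rep i n) := by
  obtain ⟨x, rfl⟩ := hn
  rw [rep_h, ← C.h_comp i j hij x, rep_h]

theorem exists_forall_mem_range {ι : Type*} (s : Finset ι) (a : ι → N) :
    ∃ i, ∀ n ∈ s, a n ∈ range (C.h i) := by
  choose k hk using fun n => C.exhaust (a n)
  exact ⟨s.sup k, fun n hn => C.range_mono (Finset.le_sup hn) (hk n)⟩

/-- The parameters of the formula `φ` under the assignment `σ` come from the `i`-th structure. -/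
def Supports (i : ℕ) (φ : Formula L.lang) (σ : ℕ → N) : Prop :=
  ∀ n ∈ φ.vars, σ n ∈ range (C.h i)

variable {C}

theorem Supports.mono {i j : ℕ} {φ : Formula L.lang} {σ : ℕ → N} (h : C.Supports i φ σ)
    (hij : i ≤ j) : C.Supports j φ σ :=
  fun n hn => C.range_mono hij (h n hn)

theorem Supports.update {i : ℕ} {φ : Formula L.lang} {σ : ℕ → N} (h : C.Supports i φ σ) (x : ℕ)
    {m : N} (hm : m ∈ range (C.h i)) : C.Supports i φ (Function.update σ x m) := by
  intro n hn
  by_cases hx : n = x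
  · simpa [hx] using hm
  · simpa [hx] using h n hn

variable (C)

theorem exists_supports (φ : Formula L.lang) (σ : ℕ → N) : ∃ i, C.Supports i φ σ :=
  C.exists_forall_mem_range φ.vars σ

theorem exists_supports₂ (φ ψ : Formula L.lang) (σ τ : ℕ → N) :
    ∃ i, C.Supports i φ σ ∧ C.Supports i ψ τ := by
  obtain ⟨i, hi⟩ := C.exists_supports φ σ
  obtain ⟨j, hj⟩ := C.exists_supports ψ τ
  exact ⟨max i j, hi.mono (le_max_left i j), hj.mono (le_max_right i j)⟩

/-- The value of `φ` in the `i`-th structure under an assignment in `N`. -/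
noncomputable def valAt (i : ℕ) (φ : Formula L.lang) (σ : ℕ → N) : TruthValue :=
  (S i).val φ (C.rep i ∘ σ)

/-- The nonstandard truth value of a formula. -/
noncomputable def hyperVal (φ : Formula L.lang) (σ : ℕ → N) : HyperTruth :=
  ((fun i => C.valAt i φ σ : ℕ → TruthValue) : HyperTruth)

variable {C}

theorem Supports.valAt_eq {i j : ℕ} {φ : Formula L.lang} {σ : ℕ → N} (h : C.Supports i φ σ)
    (hij : i ≤ j) : C.valAt j φ σ = (S j).val φ (C.f i j hij ∘ (C.rep i ∘ σ)) :=
  GodelStructure.val_congr _ φ fun n hn => C.rep_of_le hij (h n hn)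

theorem Supports.fst_valAt {i j : ℕ} {φ : Formula L.lang} {σ : ℕ → N} (h : C.Supports i φ σ)
    (hij : i ≤ j) : (C.valAt j φ σ).fst = (C.valAt i φ σ).fst := by
  rw [h.valAt_eq hij]
  exact (C.f i j hij).fst_val φ _

theorem Supports.valAt_le_iff {i j : ℕ} {φ ψ : Formula L.lang} {σ τ : ℕ → N}
    (h : C.Supports i φ σ) (h' : C.Supports i ψ τ) (hij : i ≤ j) :
    C.valAt j φ σ ≤ C.valAt j ψ τ ↔ C.valAt i φ σ ≤ C.valAt i ψ τ := by
  rw [h.valAt_eq hij, h'.valAt_eq hij]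
  exact (C.f i j hij).val_le_val_iff φ ψ _ _

end ChainCocone

theorem eventually_ge_hyperfilter (i : ℕ) : ∀ᶠ j in (hyperfilter ℕ : Filter ℕ), i ≤ j :=
  Nat.hyperfilter_le_atTop (eventually_ge_atTop i)

namespace ChainCocone

variable {L : UltrametricLanguage.{u, v}} {M : ℕ → Type w}
  {S : ∀ i, UltrametricStructure L (M i)} {N : Type w'} {C : ChainCocone S N}

theorem Supports.hasFst {i : ℕ} {φ : Formula L.lang} {σ : ℕ → N} (h : C.Supports i φ σ) :
    (C.hyperVal φ σ).HasFst (C.valAt i φ σ).fst :=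
  (eventually_ge_hyperfilter i).mono fun _ hj => h.fst_valAt hj

/-- Comparisons persist from a supporting stage to all later ones, so any one such stage decides the
order of the germs. -/
theorem Supports.hyperVal_le_iff {i : ℕ} {φ ψ : Formula L.lang} {σ τ : ℕ → N}
    (h : C.Supports i φ σ) (h' : C.Supports i ψ τ) :
    C.hyperVal φ σ ≤ C.hyperVal ψ τ ↔ C.valAt i φ σ ≤ C.valAt i ψ τ := by
  constructor
  · intro hle
    obtain ⟨j, hj, hij⟩ := (Eventually.and hle (eventually_ge_hyperfilter i)).exists
    exact (h.valAt_le_iff h' hij).1 hj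
  · exact fun hle => (eventually_ge_hyperfilter i).mono fun _ hj => (h.valAt_le_iff h' hj).2 hle

theorem Supports.hyperVal_lt_iff {i : ℕ} {φ ψ : Formula L.lang} {σ τ : ℕ → N}
    (h : C.Supports i φ σ) (h' : C.Supports i ψ τ) :
    C.hyperVal φ σ < C.hyperVal ψ τ ↔ C.valAt i φ σ < C.valAt i ψ τ := by
  rw [← not_le, ← not_le, h'.hyperVal_le_iff h]

theorem rep_comp_update (i : ℕ) (σ : ℕ → N) (x : ℕ) (m : N) :
    C.rep i ∘ Function.update σ x m = Function.update (C.rep i ∘ σ) x (C.rep i m) :=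
  Function.comp_update _ _ _ _

theorem valAt_all (i : ℕ) (x : ℕ) (φ : Formula L.lang) (σ : ℕ → N) :
    C.valAt i (.all x φ) σ = ⨆ a : M i, C.valAt i φ (Function.update σ x (C.h i a)) := by
  simp only [valAt, rep_comp_update, rep_h]
  rfl

theorem valAt_ex (i : ℕ) (x : ℕ) (φ : Formula L.lang) (σ : ℕ → N) :
    C.valAt i (.ex x φ) σ = ⨅ a : M i, C.valAt i φ (Function.update σ x (C.h i a)) := by
  simp only [valAt, rep_comp_update, rep_h]
  rfl

variable (C)

/-- The set of nonstandard truth values of formulas. -/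
def hyperVals : Set HyperTruth := {x | ∃ φ σ, C.hyperVal φ σ = x}

variable {C}

theorem hyperVal_mem (φ : Formula L.lang) (σ : ℕ → N) : C.hyperVal φ σ ∈ C.hyperVals :=
  ⟨φ, σ, rfl⟩

theorem exists_hasFst : ∀ x ∈ C.hyperVals, ∃ r, x.HasFst r := by
  rintro _ ⟨φ, σ, rfl⟩
  obtain ⟨i, hi⟩ := C.exists_supports φ σ
  exact ⟨_, hi.hasFst⟩

variable (C)

theorem exists_isRealization : ∃ G, HyperTruth.IsRealization C.hyperVals G := by
  refine HyperTruth.exists_isRealization (ι := ℕ × ℚ) exists_hasFst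
    -- The upper set for `(i, q)` is generated by the germs from stage `i` in the fibre over `r`
    -- with second coordinate above `q`. Two elements of the fibre have a common stage, and a
    -- rational fits between their second coordinates there.
    (fun r p => {x | ∃ φ σ, C.Supports p.1 φ σ ∧ (C.valAt p.1 φ σ).fst = r ∧
      (p.2 : ℝ) < (C.valAt p.1 φ σ).snd ∧ C.hyperVal φ σ ≤ x}) ?_ ?_
  · rintro r p x y hxy ⟨φ, σ, h1, h2, h3, h4⟩
    exact ⟨φ, σ, h1, h2, h3, h4.trans hxy⟩
  · rintro r _ ⟨φ, σ, rfl⟩ hx _ ⟨ψ, τ, rfl⟩ hy hxy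
    obtain ⟨i, hi, hi'⟩ := C.exists_supports₂ φ ψ σ τ
    have e1 := hi.hasFst.unique hx
    have e2 := hi'.hasFst.unique hy
    have hlt : (C.valAt i φ σ).snd < (C.valAt i ψ τ).snd := by
      rcases lt_iff.1 ((hi.hyperVal_lt_iff hi').1 hxy) with h | h
      · exact absurd h (by rw [e1, e2]; exact lt_irrefl r)
      · exact h.2
    obtain ⟨q, hq1, hq2⟩ := exists_rat_btwn hlt
    refine ⟨(i, q), ?_, ψ, τ, hi', e2, hq2, le_rfl⟩
    rintro ⟨χ, ρ, h1, h2, h3, h4⟩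
    rcases le_iff.1 ((h1.hyperVal_le_iff hi).1 h4) with h | h
    · exact absurd h (by dsimp only at h2; rw [h2, e1]; exact lt_irrefl r)
    · exact absurd (h3.trans_le h.2) hq1.not_gt

/-- The embedding of the nonstandard truth values of formulas into the truth values. -/
noncomputable def real : HyperTruth → TruthValue := C.exists_isRealization.choose

theorem isRealization_real : HyperTruth.IsRealization C.hyperVals C.real :=
  C.exists_isRealization.choose_spec

end ChainCocone

end UML

/-! ### The limit structure. -/

namespace UML

open Filter Set TruthValue

namespace ChainCocone

variable {L : UltrametricLanguage.{u, v}} {M : ℕ → Type w}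
  {S : ∀ i, UltrametricStructure L (M i)} {N : Type w'} (C : ChainCocone S N)

theorem real_hyperVal_all (x : ℕ) (φ : Formula L.lang) (σ : ℕ → N) :
    C.real (C.hyperVal (.all x φ) σ) = ⨆ m : N, C.real (C.hyperVal φ (Function.update σ x m)) := by
  obtain ⟨i, hi⟩ := C.exists_supports φ σ
  have hi' : C.Supports i (.all x φ) σ := hi
  obtain ⟨r, hr⟩ : ∃ r, (C.valAt i (.all x φ) σ).fst = r := ⟨_, rfl⟩
  have hur : (C.hyperVal (.all x φ) σ).HasFst r := hr ▸ hi'.hasFst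
  have hub : ∀ j m, C.valAt j φ (Function.update σ x m) ≤ C.valAt j (.all x φ) σ := fun j m => by
    rw [valAt, rep_comp_update]
    exact le_iSup (fun a => (S j).val φ (Function.update (C.rep j ∘ σ) x a)) (C.rep j m)
  refine C.isRealization_real.map_iSup exists_hasFst (fun m => hyperVal_mem _ _)
    (hyperVal_mem _ _) hur (fun m => ?_) ?_ (fun hne => ?_) fun q hq => ?_
  · exact Eventually.of_forall fun j => hub j m
  -- At a stage `k` supporting both formulas the supremum ranges over `M k` only, and all these
  -- instances are bounded by hypothesis.
  · rintro _ ⟨ψ, τ, rfl⟩ h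
    obtain ⟨k, hk, hk'⟩ := C.exists_supports₂ (.all x φ) ψ σ τ
    rw [hk.hyperVal_le_iff hk', valAt_all]
    exact iSup_le fun a =>
      ((Supports.update (φ := φ) hk x ⟨a, rfl⟩).hyperVal_le_iff hk').1 (h (C.h k a))
  -- All instances at stage `j` have first coordinate below `r`, hence lie below `(r, 0)`, while the
  -- supremum has first coordinate `r`.
  · refine Germ.coe_eq.2 ((eventually_ge_hyperfilter i).mono fun j hij => ?_)
    have hj := (hi'.fst_valAt hij).trans hr
    change C.valAt j (.all x φ) σ = pair r 0
    refine le_antisymm ?_ (pair_zero_le hj)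
    rw [valAt_all]
    refine iSup_le fun a => ?_
    set y := C.valAt j φ (Function.update σ x (C.h j a)) with hy
    have hya : (C.hyperVal φ (Function.update σ x (C.h j a))).HasFst y.fst :=
      ((hi.mono hij).update x ⟨a, rfl⟩).hasFst
    have hlt : y.fst < r :=
      ((fst_mono (hub j (C.h j a))).trans_eq hj).lt_of_ne fun h => hne _ (h ▸ hya)
    refine (lt_of_fst_lt ?_).le
    exact hlt.trans_eq (fst_pair ⟨y.fst_mem.1.trans_lt hlt, hur.mem_Icc.2⟩
      (left_mem_Icc.2 zero_le_one)).symm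
  -- Otherwise a rational strictly between `q` and `r` would bound the supremum already at stage
  -- `i`.
  · by_contra! hcon
    obtain ⟨q', hq1, hq2⟩ := exists_hat_between (by exact_mod_cast q.2.1) hur.mem_Icc.2 hq
    have : C.valAt i (.all x φ) σ ≤ hat q' := by
      rw [valAt_all]
      refine iSup_le fun a => (lt_of_fst_lt ?_).le
      exact (hcon _ _ (hi.update x ⟨a, rfl⟩).hasFst).trans_lt hq1
    exact (hr ▸ fst_mono this).not_gt hq2

theorem real_hyperVal_ex (x : ℕ) (φ : Formula L.lang) (σ : ℕ → N) :
    C.real (C.hyperVal (.ex x φ) σ) = ⨅ m : N, C.real (C.hyperVal φ (Function.update σ x m)) := by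
  obtain ⟨i, hi⟩ := C.exists_supports φ σ
  have hi' : C.Supports i (.ex x φ) σ := hi
  obtain ⟨r, hr⟩ : ∃ r, (C.valAt i (.ex x φ) σ).fst = r := ⟨_, rfl⟩
  have hur : (C.hyperVal (.ex x φ) σ).HasFst r := hr ▸ hi'.hasFst
  have hlb : ∀ j m, C.valAt j (.ex x φ) σ ≤ C.valAt j φ (Function.update σ x m) := fun j m => by
    rw [valAt, valAt, rep_comp_update]
    exact iInf_le (fun a => (S j).val φ (Function.update (C.rep j ∘ σ) x a)) (C.rep j m)
  refine C.isRealization_real.map_iInf exists_hasFst (fun m => hyperVal_mem _ _)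
    (hyperVal_mem _ _) hur (fun m => ?_) ?_ (fun hne => ?_) fun q hq => ?_
  · exact Eventually.of_forall fun j => hlb j m
  · rintro _ ⟨ψ, τ, rfl⟩ h
    obtain ⟨k, hk, hk'⟩ := C.exists_supports₂ (.ex x φ) ψ σ τ
    rw [hk'.hyperVal_le_iff hk, valAt_ex]
    exact le_iInf fun a =>
      (hk'.hyperVal_le_iff (Supports.update (φ := φ) hk x ⟨a, rfl⟩)).1 (h (C.h k a))
  · refine Germ.coe_eq.2 ((eventually_ge_hyperfilter i).mono fun j hij => ?_)
    have hj := (hi'.fst_valAt hij).trans hr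
    change C.valAt j (.ex x φ) σ = pair r 1
    refine le_antisymm (le_pair_one hj) ?_
    rw [valAt_ex]
    refine le_iInf fun a => ?_
    set y := C.valAt j φ (Function.update σ x (C.h j a)) with hy
    have hya : (C.hyperVal φ (Function.update σ x (C.h j a))).HasFst y.fst :=
      ((hi.mono hij).update x ⟨a, rfl⟩).hasFst
    have hlt : r < y.fst :=
      (hj.symm.trans_le (fst_mono (hlb j (C.h j a)))).lt_of_ne fun h => hne _ (h ▸ hya)
    -- For `r = 0` there is no point `(0, 1)`; `pair` takes its default value `⊥`.
    rcases hur.mem_Icc.1.eq_or_lt with h0 | h0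
    · have hbot : pair r 1 = ⊥ := by
        rw [pair, dif_neg fun h => h.1.1.ne h0]
      exact hbot.trans_le bot_le
    · exact (lt_of_fst_lt ((fst_pair ⟨h0, hur.mem_Icc.2⟩
        (right_mem_Icc.2 zero_le_one)).trans_lt hlt)).le
  · by_contra! hcon
    obtain ⟨q', hq1, hq2⟩ := exists_hat_between hur.mem_Icc.1 (by exact_mod_cast q.2.2) hq
    have : hat q' ≤ C.valAt i (.ex x φ) σ := by
      rw [valAt_ex]
      refine le_iInf fun a => (lt_of_fst_lt ?_).le
      exact hq2.trans_le (hcon _ _ (hi.update x ⟨a, rfl⟩).hasFst)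
    exact (hr ▸ fst_mono this).not_gt hq1

/-- The nonstandard truth value of an atomic formula. -/
noncomputable def hyperRel {k : ℕ} (P : L.lang.Relations k) (a : Fin k → N) : HyperTruth :=
  ((fun i => (S i).relMap P (C.rep i ∘ a) : ℕ → TruthValue) : HyperTruth)

theorem nonempty (C : ChainCocone S N) : Nonempty N := (S 0).nonempty.map (C.h 0)

theorem hyperRel_mem {k : ℕ} (P : L.lang.Relations k) (a : Fin k → N) :
    C.hyperRel P a ∈ C.hyperVals := by
  obtain ⟨m⟩ := C.nonempty
  refine ⟨.pred P fun i => .var i, fun n => if h : n < k then a ⟨n, h⟩ else m, ?_⟩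
  simp only [hyperVal, valAt, GodelStructure.val, GodelStructure.termVal, Function.comp_apply,
    Fin.is_lt, dite_true, Fin.eta]
  rfl

theorem hat_mem (q : Icc (0 : ℚ) 1) : (↑(hat q) : HyperTruth) ∈ C.hyperVals := by
  obtain ⟨m⟩ := C.nonempty
  exact ⟨.const q, fun _ => m, rfl⟩

theorem real_hat (q : Icc (0 : ℚ) 1) : C.real ↑(hat q) = hat q :=
  C.isRealization_real.map_hat q (C.hat_mem q)

/-- Interpretation of the function symbols in the limit. -/
noncomputable def limFun {k : ℕ} (f : L.lang.Functions k) (a : Fin k → N) : N :=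
  have i := (C.exists_forall_mem_range Finset.univ a).choose
  C.h i ((S i).funMap f (C.rep i ∘ a))

theorem h_funMap_rep {k : ℕ} (f : L.lang.Functions k) (a : Fin k → N) {i j : ℕ} (hij : i ≤ j)
    (ha : ∀ n, a n ∈ range (C.h i)) :
    C.h j ((S j).funMap f (C.rep j ∘ a)) = C.h i ((S i).funMap f (C.rep i ∘ a)) := by
  rw [← C.h_comp i j hij, WeakElementaryEmbedding.map_funMap]
  congr 2
  ext n
  exact C.rep_of_le hij (ha n)

/-- The chosen stage is immaterial because the embeddings commute with `f`; two stages are compared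
at their maximum. -/
theorem limFun_eq {k : ℕ} (f : L.lang.Functions k) (a : Fin k → N) {i : ℕ}
    (ha : ∀ n, a n ∈ range (C.h i)) : C.limFun f a = C.h i ((S i).funMap f (C.rep i ∘ a)) := by
  have h := (C.exists_forall_mem_range Finset.univ a).choose_spec
  set i' := (C.exists_forall_mem_range Finset.univ a).choose with hi'
  have e1 := C.h_funMap_rep f a (le_max_left i i') ha
  have e2 := C.h_funMap_rep f a (le_max_right i i') fun n => h n (Finset.mem_univ n)
  exact e2.symm.trans e1

theorem eventually_rep_limFun {k : ℕ} (f : L.lang.Functions k) (a : Fin k → N) :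
    ∀ᶠ j in (hyperfilter ℕ : Filter ℕ),
      C.rep j (C.limFun f a) = (S j).funMap f (C.rep j ∘ a) := by
  obtain ⟨i, hi⟩ := C.exists_forall_mem_range Finset.univ a
  filter_upwards [eventually_ge_hyperfilter i] with j hij
  rw [C.limFun_eq f a fun n => C.range_mono hij (hi n (Finset.mem_univ n)), rep_h]

/-- The limit of a chain, as a structure of rational Gödel logic. -/
noncomputable def limGodel : GodelStructure L.lang N where
  nonempty := C.nonempty
  funMap := C.limFun
  relMap P a := C.real (C.hyperRel P a)

theorem eventually_rep_termVal (σ : ℕ → N) (t : L.lang.Term ℕ) :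
    ∀ᶠ j in (hyperfilter ℕ : Filter ℕ),
      C.rep j (C.limGodel.termVal σ t) = (S j).termVal (C.rep j ∘ σ) t := by
  induction t with
  | var x => exact Eventually.of_forall fun j => rfl
  | func f t ih =>
    filter_upwards [eventually_all.2 ih,
      C.eventually_rep_limFun f fun i => C.limGodel.termVal σ (t i)] with j hj hj'
    refine hj'.trans ?_
    simp only [GodelStructure.termVal]
    congr 1
    ext i
    exact hj i

theorem monotoneOn_real : MonotoneOn C.real C.hyperVals :=
  C.isRealization_real.strictMonoOn.monotoneOn

/-- Induction on `φ`, in the style of Łoś's theorem. The connectives commute with germs and, by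
strict monotonicity, with `real`; the quantifiers are where preservation of bounds enters. -/
theorem val_limGodel (φ : Formula L.lang) (σ : ℕ → N) :
    C.limGodel.val φ σ = C.real (C.hyperVal φ σ) := by
  induction φ generalizing σ with
  | const r => exact (C.real_hat r).symm
  | pred P t =>
    refine congrArg C.real (Germ.coe_eq.2 ?_)
    filter_upwards [eventually_all.2 fun i => C.eventually_rep_termVal σ (t i)] with j hj
    exact congrArg ((S j).relMap P) (funext hj)
  | and φ ψ ih1 ih2 =>
    simp only [GodelStructure.val, ih1, ih2]
    rcases le_total (C.hyperVal φ σ) (C.hyperVal ψ σ) with h | h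
    · rw [max_eq_right (C.monotoneOn_real (hyperVal_mem _ _) (hyperVal_mem _ _) h)]
      exact congrArg C.real (Germ.coe_eq.2 (Eventually.mono h fun j hj => (max_eq_right hj).symm))
    · rw [max_eq_left (C.monotoneOn_real (hyperVal_mem _ _) (hyperVal_mem _ _) h)]
      exact congrArg C.real (Germ.coe_eq.2 (Eventually.mono h fun j hj => (max_eq_left hj).symm))
  | imp φ ψ ih1 ih2 =>
    simp only [GodelStructure.val, ih1, ih2]
    rcases le_or_gt (C.hyperVal ψ σ) (C.hyperVal φ σ) with h | h
    · rw [imp_of_le (C.monotoneOn_real (hyperVal_mem _ _) (hyperVal_mem _ _) h), ← C.real_hat]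
      exact congrArg C.real (Germ.coe_eq.2 (Eventually.mono h fun j hj => (imp_of_le hj).symm))
    · rw [imp_of_lt (C.isRealization_real.strictMonoOn (hyperVal_mem _ _) (hyperVal_mem _ _) h)]
      exact congrArg C.real (Germ.coe_eq.2
        ((Germ.coe_lt.1 h).mono fun j hj => (imp_of_lt hj).symm))
  | all x φ ih => simp only [GodelStructure.val, ih, C.real_hyperVal_all]
  | ex x φ ih => simp only [GodelStructure.val, ih, C.real_hyperVal_ex]

theorem comp_vec (i : ℕ) (a b : N) : C.rep i ∘ ![a, b] = ![C.rep i a, C.rep i b] := by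
  ext n
  fin_cases n <;> rfl

/-- Since `real` is strictly monotone and fixes every `r̂`, the bounds `1/n` in the moduli transfer
between the limit and the stages. -/
theorem real_lt_hat_iff {x : HyperTruth} (hx : x ∈ C.hyperVals) (q : Icc (0 : ℚ) 1) :
    C.real x < hat q ↔ x < ↑(hat q) := by
  conv_lhs => rw [← C.real_hat q]
  exact C.isRealization_real.strictMonoOn.lt_iff_lt hx (C.hat_mem q)

theorem eventually_dist_lt {k : ℕ} (a b : Fin k → N) (n : ℕ+)
    (h : (⨆ i, C.limGodel.relMap L.d ![a i, b i]) < invNat n) :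
    ∀ᶠ j in (hyperfilter ℕ : Filter ℕ),
      (⨆ i, (S j).relMap L.d ![(C.rep j ∘ a) i, (C.rep j ∘ b) i]) < invNat n := by
  have h1 : ∀ i, ∀ᶠ j in (hyperfilter ℕ : Filter ℕ),
      (S j).relMap L.d (C.rep j ∘ ![a i, b i]) < invNat n := fun i =>
    Germ.coe_lt.1 ((C.real_lt_hat_iff (C.hyperRel_mem L.d ![a i, b i]) _).1
      ((le_iSup (fun i => C.limGodel.relMap L.d ![a i, b i]) i).trans_lt h))
  filter_upwards [eventually_all.2 h1] with j hj
  -- Positivity of the bound covers the empty tuple, whose distance is `⊥`.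
  rw [← Finset.sup_univ_eq_iSup, Finset.sup_lt_iff (bot_lt_invNat n)]
  intro i _
  have := hj i
  rw [comp_vec] at this
  exact this

/-- The limit of a chain of ultrametric structures. -/
noncomputable def lim : UltrametricStructure L N where
  toGodelStructure := C.limGodel
  d_self a := by
    refine Eq.trans (congrArg C.real (Germ.coe_eq.2 (Eventually.of_forall fun j => ?_)))
      (C.real_hat 0)
    simp only [comp_vec]
    exact (S j).d_self _
  d_comm a b := by
    refine congrArg C.real (Germ.coe_eq.2 (Eventually.of_forall fun j => ?_))
    simp only [comp_vec]
    exact (S j).d_comm _ _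
  d_triangle a b c := by
    -- Phrased as a disjunction, so that the ultrafilter selects one alternative for the germs.
    have h : ∀ᶠ j in (hyperfilter ℕ : Filter ℕ),
        (S j).relMap L.d (C.rep j ∘ ![a, b]) ≤ (S j).relMap L.d (C.rep j ∘ ![a, c]) ∨
        (S j).relMap L.d (C.rep j ∘ ![a, b]) ≤ (S j).relMap L.d (C.rep j ∘ ![b, c]) :=
      Eventually.of_forall fun j => by
        simp only [comp_vec]
        exact le_max_iff.1 ((S j).d_triangle _ _ _)
    rcases Ultrafilter.eventually_or.1 h with h | h
    · exact le_max_of_le_left (C.monotoneOn_real (C.hyperRel_mem _ _) (C.hyperRel_mem _ _) h)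
    · exact le_max_of_le_right (C.monotoneOn_real (C.hyperRel_mem _ _) (C.hyperRel_mem _ _) h)
  eq_of_d_eq a b h := by
    have h1 : C.hyperRel L.d ![a, b] = ↑(hat 0) :=
      C.isRealization_real.strictMonoOn.injOn (C.hyperRel_mem _ _) (C.hat_mem 0)
        (h.trans (C.real_hat 0).symm)
    obtain ⟨i, hi⟩ := C.exhaust a
    obtain ⟨i', hi'⟩ := C.exhaust b
    obtain ⟨j, hj, hij⟩ := ((Germ.coe_eq.1 h1).and
      (eventually_ge_hyperfilter (max i i'))).exists
    have hd : (S j).relMap L.d ![C.rep j a, C.rep j b] = hat 0 := by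
      rw [← comp_vec]
      exact hj
    rw [← C.h_rep (C.range_mono ((le_max_left i i').trans hij) hi),
      ← C.h_rep (C.range_mono ((le_max_right i i').trans hij) hi'), (S j).eq_of_d_eq _ _ hd]
  fun_unifCont f n a b h := by
    refine (C.real_lt_hat_iff (C.hyperRel_mem _ _) _).2 (Germ.coe_lt.2 ?_)
    filter_upwards [C.eventually_dist_lt a b _ h, C.eventually_rep_limFun f a,
      C.eventually_rep_limFun f b] with j hj ha hb
    rw [comp_vec]
    change (S j).relMap L.d ![C.rep j (C.limFun f a), C.rep j (C.limFun f b)] < _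
    rw [ha, hb]
    exact (S j).fun_unifCont f n _ _ hj
  rel_unifCont P n a b h := by
    have h1 : ∀ᶠ j in (hyperfilter ℕ : Filter ℕ),
        dmax ((S j).relMap P (C.rep j ∘ a)) ((S j).relMap P (C.rep j ∘ b)) < invNat n :=
      (C.eventually_dist_lt a b _ h).mono fun j hj => (S j).rel_unifCont P n _ _ hj
    -- If the germs differ, the ultrafilter makes the values differ at almost every stage, where
    -- `dmax` is then the maximum and bounds both values.
    by_cases heq : C.hyperRel P a = C.hyperRel P b
    · have : dmax (C.real (C.hyperRel P a)) (C.real (C.hyperRel P b)) = hat 0 := by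
        rw [heq]
        exact if_pos rfl
      exact this.trans_lt (bot_lt_invNat n)
    · have hne : ∀ᶠ j in (hyperfilter ℕ : Filter ℕ),
          ¬ (S j).relMap P (C.rep j ∘ a) = (S j).relMap P (C.rep j ∘ b) :=
        Ultrafilter.eventually_not.2 fun h => heq (Germ.coe_eq.2 h)
      have h2 : ∀ᶠ j in (hyperfilter ℕ : Filter ℕ),
          (S j).relMap P (C.rep j ∘ a) < invNat n ∧ (S j).relMap P (C.rep j ∘ b) < invNat n := by
        filter_upwards [h1, hne] with j hj hj'
        rw [dmax, if_neg hj'] at hj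
        exact max_lt_iff.1 hj
      have hmax : max (C.real (C.hyperRel P a)) (C.real (C.hyperRel P b)) < invNat n :=
        max_lt
          ((C.real_lt_hat_iff (C.hyperRel_mem _ _) _).2 (Germ.coe_lt.2 (h2.mono fun _ h => h.1)))
          ((C.real_lt_hat_iff (C.hyperRel_mem _ _) _).2 (Germ.coe_lt.2 (h2.mono fun _ h => h.2)))
      change dmax (C.real (C.hyperRel P a)) (C.real (C.hyperRel P b)) < invNat n
      rw [dmax]
      split_ifs
      · exact bot_lt_invNat n
      · exact hmax

/-- The structures of a chain embed into the limit. -/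
noncomputable def toLim (i : ℕ) : WeakElementaryEmbedding (S i) C.lim where
  toFun := C.h i
  map_fun f a := by
    refine Eq.trans ?_ (C.limFun_eq f (C.h i ∘ a) (i := i) fun n => ⟨a n, rfl⟩).symm
    congr 2
    ext n
    exact (C.rep_h i (a n)).symm
  truthDegree_eq φ σ := by
    have hs : C.Supports i φ (C.h i ∘ σ) := fun n _ => ⟨σ n, rfl⟩
    have hσ : C.rep i ∘ (C.h i ∘ σ) = σ := funext fun n => C.rep_h i (σ n)
    rw [GodelStructure.truthDegree_eq_fst, GodelStructure.truthDegree_eq_fst]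
    change _ = (C.limGodel.val φ (C.h i ∘ σ)).fst
    rw [val_limGodel, C.isRealization_real.fst_eq (hyperVal_mem _ _) hs.hasFst, valAt, hσ]

end ChainCocone

end UML

theorem mainTheorem8 (L : UML.UltrametricLanguage) [Countable L.lang.Symbols]
    (M : ℕ → Type*) (S : ∀ i, UML.UltrametricStructure L (M i))
    (f : ∀ i j : ℕ, i ≤ j → UML.WeakElementaryEmbedding (S i) (S j))
    [DirectedSystem M (f · · ·)] :
    ∃ (T : UML.UltrametricStructure L (DirectLimit M f))
      (h : ∀ i, UML.WeakElementaryEmbedding (S i) T),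
      (∀ (i j : ℕ) (hij : i ≤ j), ⇑(h j) ∘ ⇑(f i j hij) = ⇑(h i)) ∧
      (∀ (i : ℕ) (m : M i), h i m = (⟦⟨i, m⟩⟧ : DirectLimit M f)) := by
  let C : UML.ChainCocone S (DirectLimit M f) :=
    { f := f
      h := fun i m => ⟦⟨i, m⟩⟧
      h_comp := fun i j hij x => DirectLimit.mk_apply (f := f) i j x hij
      injective := DirectLimit.mk_injective f fun i j hij => (f i j hij).injective
      exhaust := fun n => by
        obtain ⟨i, x, hx⟩ := DirectLimit.exists_eq_mk f n
        exact ⟨i, x, hx.symm⟩ }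
  exact ⟨C.lim, C.toLim, fun i j hij => funext fun x => C.h_comp i j hij x, fun i m => rfl⟩
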